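/- Let $\Bbbk$ be a field and let $V$ be a finite-dimensional $\Bbbk$-vector space with a linear action of the symmetric group $S_2$. Let $\mathcal F_V$ be the free symmetric operad generated by $V$, viewed as the $S_2$-module of binary operations, so that $\mathcal F_V(3)\cong\mathrm{Ind}_{S_2}^{S_3}(V\mathbin{\vec\otimes}V)$, where $V\mathbin{\vec\otimes}V\subseteq\mathcal F_V(3)$ is the span of the composites $v\mathbin{\vec\otimes}w=v(w(x_1,x_2),x_3)$, $v,w\in V$. For an $S_3$-submodule $R\subseteq\mathcal F_V(3)$ let $\mathcal P(V,R)=\mathcal F_V/(R)$ be the binary quadratic operad generated by $V$ with defining relations $R$. For a binary quadratic operad $\mathcal P$, let $\mathrm{As}\circ\mathcal P$ be the white Manin product of $\mathcal P$ with the operad $\mathrm{As}$ of associative algebras: the binary quadratic operad generated by the $S_2$-module $\mathrm{As}(2)\otimes\mathcal P(2)$ with the diagonal action, whose relations are the kernel of the natural map $\mathcal F_{\mathrm{As}(2)\otimes\mathcal P(2)}(3)\to\mathrm{As}(3)\otimes\mathcal P(3)$. For $v\in\mathcal P(2)$ put \[ h_v=x_1x_2\otimes v(x_1,x_2),\qquad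 g_v=x_1x_2\otimes v(x_2,x_1)\qquad\text{in }(\mathrm{As}\circ\mathcal P)(2). \] We say that $\mathcal P$ admits a nonsymmetric version if the quotient of $\mathrm{As}\circ\mathcal P$ by the operadic ideal generated by all elements $g_v-(12)h_v$ and $(12)g_v-h_v$, $v\in\mathcal P(2)$, is isomorphic to $\mathcal P$ as a symmetric operad. (If $\mathcal P(2)$ is spanned by $e_1$ and $e_2=(12)e_1$, and $g_1=g_{e_1}$, $h_1=h_{e_1}$, $g_2=(12)g_1$, $h_2=(12)h_1$, these are the identifications $g_1=h_2$ and $g_2=h_1$.) Theorem. Let $\mathcal P=\mathcal P(V,R)$ be a binary quadratic operad, and let \[ F=\big\langle\,(\Bbbk\,\mathrm{id}+\Bbbk(13))(V\mathbin{\vec\otimes}V)\cap R\,\big\rangle_{S_3} \] be the $S_3$-submodule of $\mathcal F_V(3)$ generated by the elements of $R$ that lie in $(\Bbbk\,\mathrm{id}+\Bbbk(13))(V\mathbin{\vec\otimes}V):=(V\mathbin{\vec\otimes}V)+(13)(V\mathbin{\vec\otimes}V)$. Then $\mathcal P$ admits a nonsymmetric version if and only if \[ \dim\mathcal P(V,R)(3)=\dim\mathcal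 P(V,F)(3), \] and this equality of dimensions holds if and only if $F=R$. -/

import Mathlib

open scoped TensorProduct

universe u v w

noncomputable section

/-! ### Relabelling bijections -/

/-- `A ⊕ (B ∪ {∗}) ≃ (A ⊕ B) ∪ {∗}`. -/
def sumOptionEquiv (A B : Type) : A ⊕ Option B ≃ Option (A ⊕ B) where
  toFun
    | .inl a => some (.inl a)
    | .inr none => none
    | .inr (some b) => some (.inr b)
  invFun
    | none => .inr none
    | some (.inl a) => .inl a
    | some (.inr b) => .inr (some b)
  left_inv := by rintro (a | (_ | b)) <;> rfl
  right_inv := by rintro (_ | (a | b)) <;> rfl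

/-- `(A ∪ {∗}) ⊕ B ≃ (A ⊕ B) ∪ {∗}`. -/
def optionSumEquiv (A B : Type) : Option A ⊕ B ≃ Option (A ⊕ B) where
  toFun
    | .inl none => none
    | .inl (some a) => some (.inl a)
    | .inr b => some (.inr b)
  invFun
    | none => .inl none
    | some (.inl a) => .inl (some a)
    | some (.inr b) => .inr b
  left_inv := by rintro ((_ | a) | b) <;> rfl
  right_inv := by rintro (_ | (a | b)) <;> rfl

/-- The bijection of `A ∪ {∗₁} ∪ {∗₂}` that exchanges the two added points. -/
def optionSwapEquiv (A : Type) : Option (Option A) ≃ Option (Option A) where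
  toFun
    | none => some none
    | some none => none
    | some (some a) => some (some a)
  invFun
    | none => some none
    | some none => none
    | some (some a) => some (some a)
  left_inv := by rintro (_ | (_ | a)) <;> rfl
  right_inv := by rintro (_ | (_ | a)) <;> rfl

/-- `{∗} ≃ ∅ ∪ {∗}`. -/
def unitOptionEmptyEquiv : Unit ≃ Option Empty where
  toFun _ := none
  invFun _ := ()
  left_inv _ := rfl
  right_inv := by rintro (_ | a) <;> [rfl; exact a.elim]

/-- The identification of `{0, 1}` with `{1} ∪ {∗}`, the point `0` being the distinguished one. -/
def finTwoOptionEquiv : Fin 2 ≃ Option Unit where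
  toFun i := if i = 0 then none else some ()
  invFun o := o.elim 0 (fun _ => 1)
  left_inv := by decide
  right_inv := by rintro (_ | a) <;> rfl

/-- `{∗} ⊕ A ≃ A ∪ {∗}`. -/
def unitSumOptionEquiv (A : Type) : Unit ⊕ A ≃ Option A where
  toFun
    | .inl _ => none
    | .inr a => some a
  invFun
    | none => .inl ()
    | some a => .inr a
  left_inv := by rintro (a | a) <;> rfl
  right_inv := by rintro (_ | a) <;> rfl

/-- `(A ⊕ B) ⊕ C ≃ (A ⊕ C) ⊕ B`. -/
def sumRightCommEquiv (A B C : Type) : (A ⊕ B) ⊕ C ≃ (A ⊕ C) ⊕ B where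
  toFun
    | .inl (.inl a) => .inl (.inl a)
    | .inl (.inr b) => .inr b
    | .inr c => .inl (.inr c)
  invFun
    | .inl (.inl a) => .inl (.inl a)
    | .inl (.inr c) => .inr c
    | .inr b => .inl (.inr b)
  left_inv := by rintro ((a | b) | c) <;> rfl
  right_inv := by rintro ((a | b) | c) <;> rfl

/-! ### Symmetric operads -/

/-- A symmetric operad over `k` in the category of `k`-modules, in its coordinate-free form:
the component `obj A` is given for every finite set `A` of inputs (so that `P(n)` is
`P.obj (Fin n)`), `relabel` is the action of bijections of the inputs (for `A = B = Fin n`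
this is the left action of the symmetric group), `one` is the unit, and `comp p q` is the partial
composition `p ∘_∗ q`, where `∗ = none` is a distinguished input of `p`.  As every input of `p`
can be made the distinguished one by relabelling, this gives all the partial
compositions `p ∘_i q`.  The axioms are equivariance, the two unit laws, and the sequential and
the parallel associativity of partial compositions. -/
structure Operad (k : Type u) [CommRing k] where
  obj : (A : Type) → [Finite A] → Type w
  [addCommGroup : ∀ (A : Type) [Finite A], AddCommGroup (obj A)]
  [module : ∀ (A : Type) [Finite A], Module k (obj A)]
  relabel : ∀ {A B : Type} [Finite A] [Finite B], (A ≃ B) → (obj A →ₗ[k] obj B)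
  one : obj Unit
  comp : ∀ {A B : Type} [Finite A] [Finite B], obj (Option A) →ₗ[k] obj B →ₗ[k] obj (A ⊕ B)
  relabel_refl : ∀ {A : Type} [Finite A] (p : obj A), relabel (Equiv.refl A) p = p
  relabel_trans : ∀ {A B C : Type} [Finite A] [Finite B] [Finite C] (e : A ≃ B) (f : B ≃ C)
    (p : obj A), relabel (e.trans f) p = relabel f (relabel e p)
  comp_relabel : ∀ {A A' B B' : Type} [Finite A] [Finite A'] [Finite B] [Finite B']
    (e : A ≃ A') (f : B ≃ B') (p : obj (Option A)) (q : obj B),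
    comp (relabel (Equiv.optionCongr e) p) (relabel f q) =
      relabel (Equiv.sumCongr e f) (comp p q)
  comp_one : ∀ {A : Type} [Finite A] (p : obj (Option A)),
    relabel (Equiv.optionEquivSumPUnit A).symm (comp p one) = p
  one_comp : ∀ {B : Type} [Finite B] (q : obj B),
    relabel (Equiv.emptySum Empty B) (comp (relabel unitOptionEmptyEquiv one) q) = q
  comp_seq : ∀ {A B C : Type} [Finite A] [Finite B] [Finite C]
    (p : obj (Option A)) (q : obj (Option B)) (r : obj C),
    relabel (Equiv.sumAssoc A B C) (comp (relabel (sumOptionEquiv A B) (comp p q)) r) =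
      comp p (comp q r)
  comp_par : ∀ {A B C : Type} [Finite A] [Finite B] [Finite C]
    (p : obj (Option (Option A))) (q : obj B) (r : obj C),
    comp (relabel (optionSumEquiv A B) (comp p q)) r =
      relabel (sumRightCommEquiv A C B)
        (comp (relabel (optionSumEquiv A C) (comp (relabel (optionSwapEquiv A) p) r)) q)

attribute [instance] Operad.addCommGroup Operad.module

namespace Operad

variable {k : Type u} [CommRing k]

/-- An isomorphism of symmetric operads: linear isomorphisms in all arities that commute with
relabelling, the unit and the compositions. -/
structure Iso (P : Operad.{u, v} k) (Q : Operad.{u, w} k) where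
  equiv : (A : Type) → [Finite A] → P.obj A ≃ₗ[k] Q.obj A
  map_relabel : ∀ {A B : Type} [Finite A] [Finite B] (e : A ≃ B) (p : P.obj A),
    equiv B (P.relabel e p) = Q.relabel e (equiv A p)
  map_one : equiv Unit P.one = Q.one
  map_comp : ∀ {A B : Type} [Finite A] [Finite B] (p : P.obj (Option A)) (q : P.obj B),
    equiv (A ⊕ B) (P.comp p q) = Q.comp (equiv (Option A) p) (equiv B q)

/-- The action of the symmetric group `Sₙ` on `P(n)`. -/
def rep (P : Operad.{u, w} k) (n : ℕ) : Representation k (Equiv.Perm (Fin n)) (P.obj (Fin n)) where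
  toFun σ := P.relabel σ
  map_one' := LinearMap.ext fun p => P.relabel_refl p
  map_mul' σ τ := LinearMap.ext fun p => P.relabel_trans τ σ p

/-- For a binary operation `p ∈ P(2)`, the composite `p(x, y)`: `x` is inserted into the first and
`y` into the second input of `p`. -/
def op₂ (P : Operad.{u, w} k) {A B : Type} [Finite A] [Finite B]
    (p : P.obj (Fin 2)) (x : P.obj A) (y : P.obj B) : P.obj (A ⊕ B) :=
  P.comp (P.relabel (unitSumOptionEquiv A) (P.comp (P.relabel finTwoOptionEquiv p) x)) y

/-! ### Ideals and quotients -/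

/-- An operadic ideal. -/
structure Ideal (P : Operad.{u, w} k) where
  carrier : (A : Type) → [Finite A] → Submodule k (P.obj A)
  relabel_mem : ∀ {A B : Type} [Finite A] [Finite B] (e : A ≃ B) {p : P.obj A},
    p ∈ carrier A → P.relabel e p ∈ carrier B
  comp_mem_left : ∀ {A B : Type} [Finite A] [Finite B] {p : P.obj (Option A)} (q : P.obj B),
    p ∈ carrier (Option A) → P.comp p q ∈ carrier (A ⊕ B)
  comp_mem_right : ∀ {A B : Type} [Finite A] [Finite B] (p : P.obj (Option A)) {q : P.obj B},
    q ∈ carrier B → P.comp p q ∈ carrier (A ⊕ B)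

/-- The operadic ideal generated by a set of elements of one arity, that is, the intersection of
all operadic ideals that contain the set. -/
def span (P : Operad.{u, w} k) {N : Type} [Finite N] (S : Set (P.obj N)) : P.Ideal where
  carrier A _ := ⨅ (I : P.Ideal) (_ : S ⊆ I.carrier N), I.carrier A
  relabel_mem e p hp := by
    simp only [Submodule.mem_iInf] at hp ⊢
    exact fun I hI => I.relabel_mem e (hp I hI)
  comp_mem_left q hp := by
    simp only [Submodule.mem_iInf] at hp ⊢
    exact fun I hI => I.comp_mem_left q (hp I hI)
  comp_mem_right p q hq := by
    simp only [Submodule.mem_iInf] at hq ⊢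
    exact fun I hI => I.comp_mem_right p (hq I hI)

/-- The map induced by relabelling on the quotient by an ideal. -/
def Ideal.relabelQ {P : Operad.{u, w} k} (I : P.Ideal) {A B : Type} [Finite A] [Finite B]
    (e : A ≃ B) : (P.obj A ⧸ I.carrier A) →ₗ[k] (P.obj B ⧸ I.carrier B) :=
  (I.carrier A).mapQ (I.carrier B) (P.relabel e) (fun _ hp => I.relabel_mem e hp)

/-- The map induced by composition on the quotient by an ideal. -/
def Ideal.compQ {P : Operad.{u, w} k} (I : P.Ideal) {A B : Type} [Finite A] [Finite B] :
    (P.obj (Option A) ⧸ I.carrier (Option A)) →ₗ[k] (P.obj B ⧸ I.carrier B) →ₗ[k]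
      (P.obj (A ⊕ B) ⧸ I.carrier (A ⊕ B)) :=
  (I.carrier (Option A)).liftQ
    { toFun := fun p => (I.carrier B).mapQ (I.carrier (A ⊕ B)) (P.comp p)
        (fun _ hq => I.comp_mem_right p hq)
      map_add' := fun p p' => by
        refine LinearMap.ext fun q => ?_
        obtain ⟨q, rfl⟩ := Submodule.Quotient.mk_surjective _ q
        simp
      map_smul' := fun c p => by
        refine LinearMap.ext fun q => ?_
        obtain ⟨q, rfl⟩ := Submodule.Quotient.mk_surjective _ q
        simp }
    (fun p hp => by
      refine LinearMap.ext fun q => ?_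
      obtain ⟨q, rfl⟩ := Submodule.Quotient.mk_surjective _ q
      simpa using (Submodule.Quotient.mk_eq_zero _).2 (I.comp_mem_left q hp))

theorem Ideal.relabelQ_mk {P : Operad.{u, w} k} (I : P.Ideal) {A B : Type} [Finite A] [Finite B]
    (e : A ≃ B) (p : P.obj A) :
    I.relabelQ e (Submodule.Quotient.mk p) = Submodule.Quotient.mk (P.relabel e p) := rfl

theorem Ideal.compQ_mk {P : Operad.{u, w} k} (I : P.Ideal) {A B : Type} [Finite A] [Finite B]
    (p : P.obj (Option A)) (q : P.obj B) :
    I.compQ (Submodule.Quotient.mk p) (Submodule.Quotient.mk q) =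
      Submodule.Quotient.mk (P.comp p q) := rfl

/-- The quotient of an operad by an operadic ideal. -/
def quotient (P : Operad.{u, w} k) (I : P.Ideal) : Operad.{u, w} k where
  obj A _ := P.obj A ⧸ I.carrier A
  addCommGroup _ _ := inferInstance
  module _ _ := inferInstance
  relabel e := I.relabelQ e
  one := Submodule.Quotient.mk P.one
  comp := I.compQ
  relabel_refl p := by
    obtain ⟨p, rfl⟩ := Submodule.Quotient.mk_surjective _ p
    simp only [I.relabelQ_mk, P.relabel_refl]
  relabel_trans e f p := by
    obtain ⟨p, rfl⟩ := Submodule.Quotient.mk_surjective _ p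
    simp only [I.relabelQ_mk, P.relabel_trans]
  comp_relabel e f p q := by
    obtain ⟨p, rfl⟩ := Submodule.Quotient.mk_surjective _ p
    obtain ⟨q, rfl⟩ := Submodule.Quotient.mk_surjective _ q
    simp only [I.relabelQ_mk, I.compQ_mk, P.comp_relabel]
  comp_one p := by
    obtain ⟨p, rfl⟩ := Submodule.Quotient.mk_surjective _ p
    exact congrArg Submodule.Quotient.mk (P.comp_one p)
  one_comp q := by
    obtain ⟨q, rfl⟩ := Submodule.Quotient.mk_surjective _ q
    simp only [I.relabelQ_mk, I.compQ_mk, P.one_comp]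
  comp_seq p q r := by
    obtain ⟨p, rfl⟩ := Submodule.Quotient.mk_surjective _ p
    obtain ⟨q, rfl⟩ := Submodule.Quotient.mk_surjective _ q
    obtain ⟨r, rfl⟩ := Submodule.Quotient.mk_surjective _ r
    simp only [I.relabelQ_mk, I.compQ_mk, P.comp_seq]
  comp_par p q r := by
    obtain ⟨p, rfl⟩ := Submodule.Quotient.mk_surjective _ p
    obtain ⟨q, rfl⟩ := Submodule.Quotient.mk_surjective _ q
    obtain ⟨r, rfl⟩ := Submodule.Quotient.mk_surjective _ r
    simp only [I.relabelQ_mk, I.compQ_mk]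
    rw [P.comp_par]

/-- The projection to the quotient operad. -/
def mkQ (P : Operad.{u, w} k) (I : P.Ideal) (A : Type) [Finite A] :
    P.obj A →ₗ[k] (P.quotient I).obj A :=
  (I.carrier A).mkQ

/-! ### The Hadamard product -/

/-- The Hadamard product of operads, `(P ⊗ Q)(n) = P(n) ⊗ Q(n)` with componentwise structure. -/
def hadamard (P : Operad.{u, v} k) (Q : Operad.{u, w} k) : Operad.{u, max v w} k where
  obj A _ := P.obj A ⊗[k] Q.obj A
  addCommGroup _ _ := inferInstance
  module _ _ := inferInstance
  relabel e := TensorProduct.map (P.relabel e) (Q.relabel e)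
  one := P.one ⊗ₜ Q.one
  comp := TensorProduct.map₂ P.comp Q.comp
  relabel_refl p := by
    induction p with
    | zero => simp
    | tmul x y => simp [P.relabel_refl, Q.relabel_refl]
    | add x y hx hy => simp only [map_add, hx, hy]
  relabel_trans e f p := by
    induction p with
    | zero => simp
    | tmul x y => simp [P.relabel_trans, Q.relabel_trans]
    | add x y hx hy => simp only [map_add, hx, hy]
  comp_relabel e f p q := by
    induction p with
    | zero => simp
    | add x y hx hy => simp only [map_add, LinearMap.add_apply, hx, hy]
    | tmul x y =>
      induction q with
      | zero => simp
      | add x y hx hy => simp only [map_add, hx, hy]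
      | tmul x' y' => simp [P.comp_relabel, Q.comp_relabel]
  comp_one p := by
    induction p with
    | zero => simp
    | add x y hx hy => simp only [map_add, LinearMap.add_apply, hx, hy]
    | tmul x y => simp [P.comp_one, Q.comp_one]
  one_comp q := by
    induction q with
    | zero => simp
    | add x y hx hy => simp only [map_add, hx, hy]
    | tmul x y => simp [P.one_comp, Q.one_comp]
  comp_seq p q r := by
    induction p with
    | zero => simp
    | add x y hx hy => simp only [map_add, LinearMap.add_apply, hx, hy]
    | tmul x y =>
      induction q with
      | zero => simp
      | add x y hx hy => simp only [map_add, LinearMap.add_apply, hx, hy]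
      | tmul x' y' =>
        induction r with
        | zero => simp
        | add x y hx hy => simp only [map_add, hx, hy]
        | tmul x'' y'' => simp [P.comp_seq, Q.comp_seq]
  comp_par p q r := by
    induction p with
    | zero => simp
    | add x y hx hy => simp only [map_add, LinearMap.add_apply, hx, hy]
    | tmul x y =>
      induction q with
      | zero => simp
      | add x y hx hy => simp only [map_add, LinearMap.add_apply, hx, hy]
      | tmul x' y' =>
        induction r with
        | zero => simp
        | add x y hx hy => simp only [map_add, LinearMap.add_apply, hx, hy]
        | tmul x'' y'' =>
          simp only [TensorProduct.map₂_apply_tmul, TensorProduct.map_tmul]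
          rw [P.comp_par, Q.comp_par]

end Operad

/-! ### Operads of sets and their linear spans -/

/-- A symmetric operad in the category of sets, in the same form as `Operad`. -/
structure SetOperad where
  obj : (A : Type) → [Finite A] → Type w
  relabel : ∀ {A B : Type} [Finite A] [Finite B], (A ≃ B) → obj A → obj B
  one : obj Unit
  comp : ∀ {A B : Type} [Finite A] [Finite B], obj (Option A) → obj B → obj (A ⊕ B)
  relabel_refl : ∀ {A : Type} [Finite A] (p : obj A), relabel (Equiv.refl A) p = p
  relabel_trans : ∀ {A B C : Type} [Finite A] [Finite B] [Finite C] (e : A ≃ B) (f : B ≃ C)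
    (p : obj A), relabel (e.trans f) p = relabel f (relabel e p)
  comp_relabel : ∀ {A A' B B' : Type} [Finite A] [Finite A'] [Finite B] [Finite B']
    (e : A ≃ A') (f : B ≃ B') (p : obj (Option A)) (q : obj B),
    comp (relabel (Equiv.optionCongr e) p) (relabel f q) =
      relabel (Equiv.sumCongr e f) (comp p q)
  comp_one : ∀ {A : Type} [Finite A] (p : obj (Option A)),
    relabel (Equiv.optionEquivSumPUnit A).symm (comp p one) = p
  one_comp : ∀ {B : Type} [Finite B] (q : obj B),
    relabel (Equiv.emptySum Empty B) (comp (relabel unitOptionEmptyEquiv one) q) = q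
  comp_seq : ∀ {A B C : Type} [Finite A] [Finite B] [Finite C]
    (p : obj (Option A)) (q : obj (Option B)) (r : obj C),
    relabel (Equiv.sumAssoc A B C) (comp (relabel (sumOptionEquiv A B) (comp p q)) r) =
      comp p (comp q r)
  comp_par : ∀ {A B C : Type} [Finite A] [Finite B] [Finite C]
    (p : obj (Option (Option A))) (q : obj B) (r : obj C),
    comp (relabel (optionSumEquiv A B) (comp p q)) r =
      relabel (sumRightCommEquiv A C B)
        (comp (relabel (optionSumEquiv A C) (comp (relabel (optionSwapEquiv A) p) r)) q)

/-- The operad over `k` whose components are the free modules on those of an operad of sets. -/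
def SetOperad.linearize (S : SetOperad.{w}) (k : Type u) [CommRing k] : Operad.{u, max u w} k where
  obj A _ := S.obj A →₀ k
  addCommGroup _ _ := inferInstance
  module _ _ := inferInstance
  relabel e := Finsupp.lmapDomain k k (S.relabel e)
  one := Finsupp.single S.one 1
  comp := Finsupp.linearCombination k fun p => Finsupp.lmapDomain k k (S.comp p)
  relabel_refl p := by
    induction p using Finsupp.induction_linear with
    | zero => simp
    | add x y hx hy => simp only [map_add, hx, hy]
    | single s c => simp [S.relabel_refl]
  relabel_trans e f p := by
    induction p using Finsupp.induction_linear with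
    | zero => simp
    | add x y hx hy => simp only [map_add, hx, hy]
    | single s c => simp [S.relabel_trans]
  comp_relabel e f p q := by
    induction p using Finsupp.induction_linear with
    | zero => simp
    | add x y hx hy => simp only [map_add, LinearMap.add_apply, hx, hy]
    | single s c =>
      induction q using Finsupp.induction_linear with
      | zero => simp
      | add x y hx hy => simp only [map_add, hx, hy]
      | single t d =>
        simp only [Finsupp.linearCombination_single, Finsupp.lmapDomain_apply, Finsupp.mapDomain_single,
          LinearMap.smul_apply, Finsupp.smul_single, smul_eq_mul, S.comp_relabel]
  comp_one p := by
    induction p using Finsupp.induction_linear with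
    | zero => simp
    | add x y hx hy => simp only [map_add, LinearMap.add_apply, hx, hy]
    | single s c => simp [S.comp_one]
  one_comp q := by
    induction q using Finsupp.induction_linear with
    | zero => simp
    | add x y hx hy => simp only [map_add, hx, hy]
    | single s c => simp [S.one_comp]
  comp_seq p q r := by
    induction p using Finsupp.induction_linear with
    | zero => simp
    | add x y hx hy => simp only [map_add, LinearMap.add_apply, hx, hy]
    | single s c =>
      induction q using Finsupp.induction_linear with
      | zero => simp
      | add x y hx hy => simp only [map_add, LinearMap.add_apply, hx, hy]
      | single t d =>
        induction r using Finsupp.induction_linear with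
        | zero => simp
        | add x y hx hy => simp only [map_add, hx, hy]
        | single t' d' =>
          simp only [Finsupp.linearCombination_single, Finsupp.lmapDomain_apply, Finsupp.mapDomain_single,
            LinearMap.smul_apply, Finsupp.smul_single, smul_eq_mul,
            S.comp_seq, mul_assoc]
  comp_par p q r := by
    induction p using Finsupp.induction_linear with
    | zero => simp
    | add x y hx hy => simp only [map_add, LinearMap.add_apply, hx, hy]
    | single s c =>
      induction q using Finsupp.induction_linear with
      | zero => simp
      | add x y hx hy => simp only [map_add, LinearMap.add_apply, hx, hy]
      | single t d =>
        induction r using Finsupp.induction_linear with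
        | zero => simp
        | add x y hx hy => simp only [map_add, LinearMap.add_apply, hx, hy]
        | single t' d' =>
          simp only [Finsupp.linearCombination_single, Finsupp.lmapDomain_apply,
            Finsupp.mapDomain_single, LinearMap.smul_apply, Finsupp.smul_single, smul_eq_mul]
          rw [S.comp_par, mul_right_comm]

/-- The basis element of the linear span that is given by an element of an operad of sets. -/
def SetOperad.single (S : SetOperad.{w}) (k : Type u) [CommRing k] {A : Type} [Finite A]
    (s : S.obj A) : (S.linearize k).obj A :=
  Finsupp.single s 1

/-! ### The associative operad -/

/-- The multilinear associative monomials in the variables `a ∈ A`: nonempty words in which every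
variable occurs exactly once. -/
def AssocWord (A : Type) : Type :=
  {l : List A // l ≠ [] ∧ l.Nodup ∧ ∀ a, a ∈ l}

/-- The substitution of the word `m` for the variable `∗ = none`. -/
def assocGraft {A B : Type} (m : List B) : Option A → List (A ⊕ B)
  | none => m.map Sum.inr
  | some a => [Sum.inl a]

theorem assocGraft_word {A B : Type} {l : List (Option A)} {m : List B}
    (hl : l ≠ [] ∧ l.Nodup ∧ ∀ a, a ∈ l) (hm : m ≠ [] ∧ m.Nodup ∧ ∀ b, b ∈ m) :
    l.flatMap (assocGraft m) ≠ [] ∧ (l.flatMap (assocGraft m)).Nodup ∧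
      ∀ x, x ∈ l.flatMap (assocGraft m) := by
  refine ⟨?_, ?_, ?_⟩
  · obtain ⟨b, hb⟩ := List.exists_mem_of_ne_nil m hm.1
    refine List.ne_nil_of_mem (a := Sum.inr b) ?_
    exact List.mem_flatMap.2 ⟨none, hl.2.2 _, by simpa [assocGraft] using hb⟩
  · refine List.nodup_flatMap.2 ⟨?_, ?_⟩
    · rintro (_ | a) _
      · exact hm.2.1.map Sum.inr_injective
      · simp [assocGraft]
    · refine hl.2.1.imp ?_
      rintro (_ | a) (_ | b) hab <;> simp_all [assocGraft, Function.onFun, List.Disjoint]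
  · rintro (a | b)
    · exact List.mem_flatMap.2 ⟨some a, hl.2.2 _, by simp [assocGraft]⟩
    · exact List.mem_flatMap.2 ⟨none, hl.2.2 _, by simpa [assocGraft] using hm.2.2 b⟩

/-- Multilinear associative monomials with substitution of monomials for variables. -/
def assocSetOperad : SetOperad.{0} where
  obj A _ := AssocWord A
  relabel e l := ⟨l.1.map e, by simpa using l.2.1, l.2.2.1.map e.injective, fun b => by
    simpa using ⟨e.symm b, l.2.2.2 _, by simp⟩⟩
  one := ⟨[()], by simp⟩
  comp {A B} _ _ l m := ⟨l.1.flatMap (assocGraft m.1), assocGraft_word l.2 m.2⟩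
  relabel_refl p := Subtype.ext (by simp)
  relabel_trans e f p := Subtype.ext (by simp)
  comp_relabel e f p q := Subtype.ext (by
    simp only [List.flatMap_map, List.map_flatMap]
    refine List.flatMap_congr fun o _ => ?_
    cases o <;> simp [assocGraft])
  comp_one p := Subtype.ext (by
    simp only [List.map_flatMap]
    refine (List.flatMap_congr fun o _ => ?_).trans (List.flatMap_singleton' p.1)
    cases o <;> simp [assocGraft])
  one_comp q := Subtype.ext (by
    simp only [List.map_cons, List.map_nil, unitOptionEmptyEquiv, Equiv.coe_fn_mk,
      List.flatMap_singleton, assocGraft, List.map_map]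
    exact (List.map_congr_left fun _ _ => rfl).trans (List.map_id _))
  comp_seq p q r := Subtype.ext (by
    simp only [List.flatMap_map, List.map_flatMap, List.flatMap_assoc]
    refine List.flatMap_congr fun o _ => ?_
    cases o
    · simp only [assocGraft, List.flatMap_map, List.map_flatMap]
      refine List.flatMap_congr fun o _ => ?_
      cases o <;> simp [sumOptionEquiv]
    · simp [sumOptionEquiv, assocGraft])
  comp_par p q r := Subtype.ext (by
    simp only [List.flatMap_map, List.map_flatMap, List.flatMap_assoc]
    refine List.flatMap_congr fun o _ => ?_
    rcases o with _ | _ | a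
    · simp only [assocGraft, List.flatMap_map, optionSwapEquiv, optionSumEquiv, Equiv.coe_fn_mk,
        List.flatMap_singleton, List.map_map]
      exact (List.map_eq_flatMap (f := fun b => Sum.inl (Sum.inr b)) (l := q.1)).symm
    · simp only [assocGraft, List.flatMap_map, optionSwapEquiv, optionSumEquiv, Equiv.coe_fn_mk,
        List.flatMap_singleton, List.map_cons, List.map_nil]
      exact List.map_eq_flatMap
    · rfl)

/-- A multilinear word as an element of the operad of associative monomials. -/
def assocMonomial {A : Type} [Finite A] (l : List A) (h : l ≠ [] ∧ l.Nodup ∧ ∀ a, a ∈ l) :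
    assocSetOperad.obj A :=
  ⟨l, h⟩

/-- The operad `As` of (non-unital) associative algebras: `As(n)` has as its basis the monomials
`x_{σ(1)} ⋯ x_{σ(n)}`. -/
abbrev assocOperad (k : Type u) [CommRing k] : Operad.{u, u} k :=
  assocSetOperad.linearize k

/-- The generator `x₁x₂` of `As`. -/
def assocMul (k : Type u) [CommRing k] : (assocOperad k).obj (Fin 2) :=
  assocSetOperad.single k (assocMonomial [0, 1] (by decide))

/-! ### Tree monomials -/

/-- Nonassociative monomials in variables `a ∈ A`: planar binary rooted trees whose leaves are
labelled by `A` and whose inner vertices are labelled by a set `X` of binary operations. -/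
inductive BinTree (X : Type v) (A : Type) : Type v
  | leaf (a : A) : BinTree X A
  | node (x : X) (l r : BinTree X A) : BinTree X A

namespace BinTree

variable {X : Type v} {A B C : Type}

/-- Substitution of trees for the leaves. -/
def bind (f : A → BinTree X B) : BinTree X A → BinTree X B
  | leaf a => f a
  | node x l r => node x (bind f l) (bind f r)

/-- The word of the leaves, from the left to the right. -/
def leaves : BinTree X A → List A
  | leaf a => [a]
  | node _ l r => leaves l ++ leaves r

/-- A tree monomial is multilinear if every variable occurs exactly once. -/
def IsMultilinear (t : BinTree X A) : Prop :=
  t.leaves.Nodup ∧ ∀ a, a ∈ t.leaves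

/-- The set of the leaves of a tree. -/
def Pos : BinTree X A → Type
  | leaf _ => Unit
  | node _ l r => Pos l ⊕ Pos r

/-- The variable at a leaf. -/
def label : (t : BinTree X A) → t.Pos → A
  | leaf a, _ => a
  | node _ l _, .inl i => label l i
  | node _ _ r, .inr i => label r i

theorem bind_bind (f : A → BinTree X B) (g : B → BinTree X C) (t : BinTree X A) :
    (t.bind f).bind g = t.bind fun a => (f a).bind g := by
  induction t with
  | leaf a => rfl
  | node x l r hl hr => simp only [bind, hl, hr]

theorem bind_leaf (t : BinTree X A) : t.bind leaf = t := by
  induction t with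
  | leaf a => rfl
  | node x l r hl hr => simp only [bind, hl, hr]

theorem leaves_bind (f : A → BinTree X B) (t : BinTree X A) :
    (t.bind f).leaves = t.leaves.flatMap fun a => (f a).leaves := by
  induction t with
  | leaf a => simp [bind, leaves]
  | node x l r hl hr => simp [bind, leaves, hl, hr]

theorem leaves_ne_nil (t : BinTree X A) : t.leaves ≠ [] := by
  induction t with
  | leaf a => simp [leaves]
  | node x l r hl hr => simp [leaves, hl]

instance finite_pos (t : BinTree X A) : Finite t.Pos := by
  induction t with
  | leaf a => exact inferInstanceAs (Finite Unit)
  | node x l r hl hr => exact inferInstanceAs (Finite (l.Pos ⊕ r.Pos))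

theorem mem_leaves {t : BinTree X A} {a : A} : a ∈ t.leaves ↔ ∃ i, t.label i = a := by
  induction t with
  | leaf b => exact ⟨fun h => ⟨(), (List.mem_singleton.1 h).symm⟩,
      fun ⟨_, h⟩ => List.mem_singleton.2 h.symm⟩
  | node x l r hl hr =>
    rw [leaves, List.mem_append, hl, hr]
    exact ⟨by rintro (⟨i, h⟩ | ⟨i, h⟩) <;> [exact ⟨.inl i, h⟩; exact ⟨.inr i, h⟩],
      by rintro ⟨i | i, h⟩ <;> [exact .inl ⟨i, h⟩; exact .inr ⟨i, h⟩]⟩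

theorem label_injective {t : BinTree X A} (h : t.leaves.Nodup) : Function.Injective t.label := by
  induction t with
  | leaf b => exact fun _ _ _ => rfl
  | node x l r hl hr =>
    rw [leaves, List.nodup_append'] at h
    rintro (i | i) (j | j) hij
    · exact congrArg Sum.inl (hl h.1 hij)
    · exact (h.2.2 (mem_leaves.2 ⟨i, rfl⟩) (mem_leaves.2 ⟨j, hij.symm⟩)).elim
    · exact (h.2.2 (mem_leaves.2 ⟨j, rfl⟩) (mem_leaves.2 ⟨i, hij⟩)).elim
    · exact congrArg Sum.inr (hr h.2.1 hij)

/-- The leaves of a multilinear tree monomial are in bijection with the variables. -/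
def labelEquiv (t : BinTree X A) (h : t.IsMultilinear) : t.Pos ≃ A :=
  Equiv.ofBijective t.label ⟨label_injective h.1, fun a => mem_leaves.1 (h.2 a)⟩

/-- The tree substituted for a variable in the insertion of the tree `s` into the leaf
`∗ = none`. -/
def graftAt (s : BinTree X B) : Option A → BinTree X (A ⊕ B)
  | none => s.bind fun b => leaf (.inr b)
  | some a => leaf (.inl a)

theorem isMultilinear_relabel (e : A ≃ B) {t : BinTree X A} (ht : t.IsMultilinear) :
    (t.bind fun a => leaf (e a)).IsMultilinear := by
  have h : (t.bind fun a => leaf (X := X) (e a)).leaves = t.leaves.map e := by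
    rw [leaves_bind, List.map_eq_flatMap]; rfl
  rw [IsMultilinear, h]
  exact ⟨ht.1.map e.injective, fun b => List.mem_map.2 ⟨e.symm b, ht.2 _, by simp⟩⟩

theorem isMultilinear_graft {t : BinTree X (Option A)} {s : BinTree X B} (ht : t.IsMultilinear)
    (hs : s.IsMultilinear) : (t.bind (graftAt s)).IsMultilinear := by
  have h : (t.bind (graftAt s)).leaves = t.leaves.flatMap (assocGraft s.leaves) := by
    rw [leaves_bind]
    refine List.flatMap_congr fun o _ => ?_
    cases o with
    | none => rw [graftAt, leaves_bind, assocGraft, List.map_eq_flatMap]; rfl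
    | some a => rfl
  rw [IsMultilinear, h]
  exact (assocGraft_word ⟨t.leaves_ne_nil, ht⟩ ⟨s.leaves_ne_nil, hs⟩).2

theorem isMultilinear_gen (x : X) :
    (node x (leaf 0) (leaf 1) : BinTree X (Fin 2)).IsMultilinear := by
  simp [IsMultilinear, leaves]

theorem isMultilinear_left (x y : X) :
    (node x (node y (leaf 0) (leaf 1)) (leaf 2) : BinTree X (Fin 3)).IsMultilinear := by
  constructor <;> simp [leaves, Fin.forall_fin_succ]

end BinTree

/-- Multilinear tree monomials with substitution of monomials for variables: the free operad of
sets on a set `X` of binary operations (without symmetries). -/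
def treeSetOperad (X : Type v) : SetOperad.{v} where
  obj A _ := {t : BinTree X A // t.IsMultilinear}
  relabel e t := ⟨t.1.bind fun a => .leaf (e a), BinTree.isMultilinear_relabel e t.2⟩
  one := ⟨.leaf (), by simp [BinTree.IsMultilinear, BinTree.leaves]⟩
  comp t s := ⟨t.1.bind (BinTree.graftAt s.1), BinTree.isMultilinear_graft t.2 s.2⟩
  relabel_refl t := Subtype.ext (BinTree.bind_leaf t.1)
  relabel_trans e f t := Subtype.ext
    (BinTree.bind_bind (fun a => .leaf (e a)) (fun b => .leaf (f b)) t.1).symm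
  comp_relabel e f t s := Subtype.ext (by
    simp only [BinTree.bind_bind]
    congr 1; funext o
    cases o <;> simp [BinTree.graftAt, BinTree.bind, BinTree.bind_bind])
  comp_one t := Subtype.ext (by
    simp only [BinTree.bind_bind]
    refine (congrArg (fun f => BinTree.bind f t.1) ?_).trans (BinTree.bind_leaf t.1)
    funext o
    cases o <;> simp [BinTree.graftAt, BinTree.bind])
  one_comp t := Subtype.ext (by
    simp only [BinTree.bind_bind, BinTree.bind, unitOptionEmptyEquiv, Equiv.coe_fn_mk,
      BinTree.graftAt]
    exact BinTree.bind_leaf t.1)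
  comp_seq p q r := Subtype.ext (by
    simp only [BinTree.bind_bind]
    congr 1; funext o
    cases o
    · simp only [BinTree.graftAt, BinTree.bind_bind, BinTree.bind]
      congr 1; funext o
      cases o <;> simp [BinTree.bind, BinTree.bind_bind, sumOptionEquiv]
    · simp [BinTree.graftAt, BinTree.bind, sumOptionEquiv])
  comp_par p q r := Subtype.ext (by
    simp only [BinTree.bind_bind]
    congr 1; funext o
    rcases o with _ | _ | a <;>
      simp [BinTree.graftAt, BinTree.bind, BinTree.bind_bind, optionSumEquiv, optionSwapEquiv,
        sumRightCommEquiv])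

/-- A multilinear tree monomial as an element of the operad of tree monomials. -/
def treeMonomial {X : Type v} {A : Type} [Finite A] (t : BinTree X A) (h : t.IsMultilinear) :
    (treeSetOperad X).obj A :=
  ⟨t, h⟩

/-- The operad of linear combinations of multilinear tree monomials. -/
abbrev treeOperad (k : Type u) [CommRing k] (X : Type v) : Operad.{u, max u v} k :=
  (treeSetOperad X).linearize k

/-- The tree monomial `x(x₁, x₂)`. -/
def treeGen (k : Type u) [CommRing k] {X : Type v} (x : X) : (treeOperad k X).obj (Fin 2) :=
  (treeSetOperad X).single k (treeMonomial (.node x (.leaf 0) (.leaf 1)) (BinTree.isMultilinear_gen x))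

/-- The tree monomial `x(y(x₁, x₂), x₃)`. -/
def treeLeft (k : Type u) [CommRing k] {X : Type v} (x y : X) : (treeOperad k X).obj (Fin 3) :=
  (treeSetOperad X).single k (treeMonomial (.node x (.node y (.leaf 0) (.leaf 1)) (.leaf 2))
    (BinTree.isMultilinear_left x y))

/-- The value of a tree in an operad in which every label `x` is interpreted as a binary
operation `f x`; the inputs of the result are the leaves of the tree. -/
def BinTree.eval {k : Type u} [CommRing k] (P : Operad.{u, w} k) {X : Type v} {A : Type}
    (f : X → P.obj (Fin 2)) : (t : BinTree X A) → P.obj t.Pos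
  | leaf _ => P.one
  | node x l r => P.op₂ (f x) (eval P f l) (eval P f r)

/-- The linear maps `T_X(A) → P(A)` of the operad morphism from the tree operad to `P` that sends
every generator `x` to `f x`. -/
def treeEval {k : Type u} [CommRing k] (P : Operad.{u, w} k) {X : Type v}
    (f : X → P.obj (Fin 2)) (A : Type) [Finite A] :
    (treeOperad k X).obj A →ₗ[k] P.obj A :=
  Finsupp.linearCombination k fun t : {t : BinTree X A // t.IsMultilinear} =>
    P.relabel (t.1.labelEquiv t.2) (t.1.eval P f)

/-! ### Free operads, quadratic operads, the white product -/

section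

variable {k : Type u} [CommRing k] {V : Type v} [AddCommGroup V] [Module k V]

/-- The relations in arity two which make the generators `v(x₁, x₂)` depend linearly
and `S₂`-equivariantly on `v ∈ V`. -/
def generatorRelations (ρ : Representation k (Equiv.Perm (Fin 2)) V) :
    Set ((treeOperad k V).obj (Fin 2)) :=
  {x | ∃ v w : V, x = treeGen k (v + w) - treeGen k v - treeGen k w} ∪
  {x | ∃ (c : k) (v : V), x = treeGen k (c • v) - c • treeGen k v} ∪
  {x | ∃ (σ : Equiv.Perm (Fin 2)) (v : V),
    x = treeGen k (ρ σ v) - (treeOperad k V).relabel σ (treeGen k v)}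

/-- The ideal of the tree operad generated by `generatorRelations`. -/
def generatorIdeal (ρ : Representation k (Equiv.Perm (Fin 2)) V) : (treeOperad k V).Ideal :=
  (treeOperad k V).span (generatorRelations ρ)

/-- The free operad generated by an `S₂`-module `V` of binary operations. -/
def freeOperad (ρ : Representation k (Equiv.Perm (Fin 2)) V) : Operad.{u, max u v} k :=
  (treeOperad k V).quotient (generatorIdeal ρ)

/-- The projection from tree monomials to the free operad. -/
def freeMk (ρ : Representation k (Equiv.Perm (Fin 2)) V) (A : Type) [Finite A] :
    (treeOperad k V).obj A →ₗ[k] (freeOperad ρ).obj A :=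
  (treeOperad k V).mkQ (generatorIdeal ρ) A

/-- The generator `v(x₁, x₂)` of the free operad. -/
def freeGen (ρ : Representation k (Equiv.Perm (Fin 2)) V) (v : V) :
    (freeOperad ρ).obj (Fin 2) :=
  freeMk ρ (Fin 2) (treeGen k v)

/-- The binary quadratic operad `𝓟(V, R)` generated by the `S₂`-module `V` of binary operations
with defining relations `R ⊆ 𝓕_V(3)`. -/
def quadraticOperad (ρ : Representation k (Equiv.Perm (Fin 2)) V)
    (R : Submodule k ((freeOperad ρ).obj (Fin 3))) : Operad.{u, max u v} k :=
  (freeOperad ρ).quotient ((freeOperad ρ).span (R : Set ((freeOperad ρ).obj (Fin 3))))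

/-- The subspace `V ⊗⃗ V` of `𝓕_V(3)`, spanned by the composites
`v ⊗⃗ w = v(w(x₁, x₂), x₃)`. -/
def leftComposites (ρ : Representation k (Equiv.Perm (Fin 2)) V) :
    Submodule k ((freeOperad ρ).obj (Fin 3)) :=
  Submodule.span k (Set.range fun p : V × V => freeMk ρ (Fin 3) (treeLeft k p.1 p.2))

/-- The subspace `(k id + k (13)) (V ⊗⃗ V) = (V ⊗⃗ V) + (13) (V ⊗⃗ V)` of `𝓕_V(3)`. -/
def outerComposites (ρ : Representation k (Equiv.Perm (Fin 2)) V) :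
    Submodule k ((freeOperad ρ).obj (Fin 3)) :=
  leftComposites ρ ⊔ (leftComposites ρ).map ((freeOperad ρ).relabel (Equiv.swap (0 : Fin 3) 2))

/-- The `S₃`-submodule `F` of `𝓕_V(3)` generated by the elements of `R` that lie in
`(k id + k (13)) (V ⊗⃗ V)`. -/
def outerRelations (ρ : Representation k (Equiv.Perm (Fin 2)) V)
    (R : Submodule k ((freeOperad ρ).obj (Fin 3))) :
    Submodule k ((freeOperad ρ).obj (Fin 3)) :=
  ⨆ σ : Equiv.Perm (Fin 3), (outerComposites ρ ⊓ R).map ((freeOperad ρ).relabel σ)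

/-- The relations in arity three that hold between the binary operations of an operad `H`: the
kernel of the map `𝓕_{H(2)}(3) → H(3)` of the operad morphism from the free operad on the
`S₂`-module `H(2)` to `H` that is the identity on generators.  It consists of the classes of those
linear combinations of tree monomials labelled by `H(2)` whose value in `H(3)` is zero. -/
def arityThreeRelations (H : Operad.{u, w} k) :
    Submodule k ((freeOperad (H.rep 2)).obj (Fin 3)) :=
  (LinearMap.ker (treeEval H (fun h : H.obj (Fin 2) => h) (Fin 3))).map
    (freeMk (H.rep 2) (Fin 3))

/-- The white Manin product of (binary quadratic) operads: the binary quadratic operad generated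
by `P(2) ⊗ Q(2)` whose relations are the kernel of
`𝓕_{P(2) ⊗ Q(2)}(3) → P(3) ⊗ Q(3)`. -/
def whiteProduct (P : Operad.{u, v} k) (Q : Operad.{u, w} k) : Operad.{u, max u v w} k :=
  quadraticOperad ((P.hadamard Q).rep 2) (arityThreeRelations (P.hadamard Q))

/-- The binary operation `p ⊗ q` of the white product, for `p ∈ P(2)` and `q ∈ Q(2)`. -/
def whiteGen (P : Operad.{u, v} k) (Q : Operad.{u, w} k) (p : P.obj (Fin 2))
    (q : Q.obj (Fin 2)) : (whiteProduct P Q).obj (Fin 2) :=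
  Operad.mkQ _ _ _ (freeGen ((P.hadamard Q).rep 2) (p ⊗ₜ[k] q))

/-- The operation `h_v = x₁x₂ ⊗ v(x₁, x₂)` of `As ∘ P`, for `v ∈ P(2)`, usually written as
`x₁ ≺ x₂`. -/
def precOp (P : Operad.{u, w} k) (v : P.obj (Fin 2)) :
    (whiteProduct (assocOperad k) P).obj (Fin 2) :=
  whiteGen (assocOperad k) P (assocMul k) v

/-- The operation `g_v = x₁x₂ ⊗ v(x₂, x₁)` of `As ∘ P`, for `v ∈ P(2)`, usually written as
`x₁ ≻ x₂`. -/
def succOp (P : Operad.{u, w} k) (v : P.obj (Fin 2)) :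
    (whiteProduct (assocOperad k) P).obj (Fin 2) :=
  whiteGen (assocOperad k) P (assocMul k) (P.relabel (Equiv.swap 0 1) v)

/-- The relations `g_v = (12) h_v` and `(12) g_v = h_v` in `As ∘ P`, for all `v ∈ P(2)`. -/
def identifications (P : Operad.{u, w} k) :
    Set ((whiteProduct (assocOperad k) P).obj (Fin 2)) :=
  {x | ∃ v : P.obj (Fin 2), x = succOp P v -
    (whiteProduct (assocOperad k) P).relabel (Equiv.swap 0 1) (precOp P v)} ∪
  {x | ∃ v : P.obj (Fin 2), x =
    (whiteProduct (assocOperad k) P).relabel (Equiv.swap 0 1) (succOp P v) - precOp P v}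

/-- `P` admits a nonsymmetric version if `As ∘ P` modulo the identifications `g_v = (12) h_v`,
`(12) g_v = h_v` is isomorphic to `P`. -/
def AdmitsNonsymmetricVersion (P : Operad.{u, w} k) : Prop :=
  Nonempty (Operad.Iso
    ((whiteProduct (assocOperad k) P).quotient
      ((whiteProduct (assocOperad k) P).span (identifications P))) P)

end

end

-- The theorem follows from an isomorphism that holds for every quadratic operad P = 𝓟(V, R): the
-- quotient of As ∘ P by the identifications is 𝓟(V, F) (`identifiedProductIso`). Granting it, a
-- nonsymmetric version of P is an isomorphism between 𝓟(V, F) and 𝓟(V, R). Such an isomorphism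
-- preserves the dimension in arity three. There the two operads are 𝓕_V(3)/F and 𝓕_V(3)/R with F ≤
-- R, all finite-dimensional, so equal dimensions mean F = R (`rank_quadraticOperad_eq_iff`).
-- Conversely, F = R makes the two operads equal.
--
-- The identifications say exactly that x₂x₁ ⊗ v = x₁x₂ ⊗ v, so the word carried by a generator is
-- forgotten. In one direction the map is s ⊗ v ↦ v. It must send the relations of As ∘ P to F
-- (`freeMk_treeMap_mem_outerRelations`). Evaluate a relation in As ⊗ 𝓕_V instead of As ⊗ P and
-- write the value as a sum of s ⊗ r_s over the words s. Its vanishing in As ⊗ P says that every r_s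
-- lies in R. The only trees compatible with the word x₁x₂x₃ are (x₁x₂)x₃ and x₁(x₂x₃), so the r_s
-- of that word also lies in (V ⊗⃗ V) + (13)(V ⊗⃗ V) (`coord_relabel_leftComp_mem`). Other words are
-- permutations of this one, so every r_s lies in F, and forgetting the words gives the sum of the
-- r_s.
--
-- In the other direction the map is v ↦ x₁x₂ ⊗ v. A generator of F is r = p + (13)q in R with p and
-- q in V ⊗⃗ V. Lift p with the word x₁x₂ at all vertices and (13)q with the word x₂x₁ at all
-- vertices. Both lifts then evaluate to the word x₁x₂x₃, so their sum evaluates to x₁x₂x₃ ⊗ r = 0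
-- and is a relation of As ∘ P (`freeToIdentified_eq_zero`). The two maps are inverse to each other
-- on generators, hence everywhere (`Operad.Hom.tree_ext`).

universe w' w''

noncomputable section

/-! ### Morphisms of operads, kernels and factorization through quotients. -/

namespace Operad

variable {k : Type u} [CommRing k]

/-- A morphism of symmetric operads. -/
structure Hom (P : Operad.{u, v} k) (Q : Operad.{u, w} k) where
  app : (A : Type) → [Finite A] → P.obj A →ₗ[k] Q.obj A
  map_relabel : ∀ {A B : Type} [Finite A] [Finite B] (e : A ≃ B) (p : P.obj A),
    app B (P.relabel e p) = Q.relabel e (app A p)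
  map_one : app Unit P.one = Q.one
  map_comp : ∀ {A B : Type} [Finite A] [Finite B] (p : P.obj (Option A)) (q : P.obj B),
    app (A ⊕ B) (P.comp p q) = Q.comp (app (Option A) p) (app B q)

namespace Hom

variable {P : Operad.{u, v} k} {Q : Operad.{u, w} k} {S : Operad.{u, w'} k}

/-- The composition of morphisms. -/
def trans (φ : Hom P Q) (ψ : Hom Q S) : Hom P S where
  app A _ := ψ.app A ∘ₗ φ.app A
  map_relabel e p := by simp [φ.map_relabel, ψ.map_relabel]
  map_one := by simp [φ.map_one, ψ.map_one]
  map_comp p q := by simp [φ.map_comp, ψ.map_comp]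

@[simp] theorem trans_app (φ : Hom P Q) (ψ : Hom Q S) {A : Type} [Finite A] (p : P.obj A) :
    (φ.trans ψ).app A p = ψ.app A (φ.app A p) := rfl

/-- The kernel of a morphism. -/
def ker (φ : Hom P Q) : P.Ideal where
  carrier A _ := LinearMap.ker (φ.app A)
  relabel_mem e p hp := by
    rw [LinearMap.mem_ker] at hp ⊢; rw [φ.map_relabel, hp, map_zero]
  comp_mem_left q hp := by
    rw [LinearMap.mem_ker] at hp ⊢; rw [φ.map_comp, hp, map_zero, LinearMap.zero_apply]
  comp_mem_right p q hq := by
    rw [LinearMap.mem_ker] at hq ⊢; rw [φ.map_comp, hq, map_zero]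

theorem map_op₂ (φ : Hom P Q) {A B : Type} [Finite A] [Finite B] (p : P.obj (Fin 2))
    (x : P.obj A) (y : P.obj B) :
    φ.app (A ⊕ B) (P.op₂ p x y) = Q.op₂ (φ.app _ p) (φ.app _ x) (φ.app _ y) := by
  simp only [op₂, φ.map_comp, φ.map_relabel]

/-- Two morphisms that are inverse to each other give an isomorphism. -/
def toIso (φ : Hom P Q) (ψ : Hom Q P) (h₁ : ∀ (A : Type) [Finite A] (p : P.obj A),
    ψ.app A (φ.app A p) = p) (h₂ : ∀ (A : Type) [Finite A] (q : Q.obj A),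
    φ.app A (ψ.app A q) = q) : Iso P Q where
  equiv A _ := LinearEquiv.ofLinearMap (φ.app A) (ψ.app A) (LinearMap.ext (h₂ A))
    (LinearMap.ext (h₁ A))
  map_relabel := φ.map_relabel
  map_one := φ.map_one
  map_comp := φ.map_comp

end Hom

theorem subset_span (P : Operad.{u, w} k) {N : Type} [Finite N] (S : Set (P.obj N)) :
    S ⊆ (P.span S).carrier N := by
  intro s hs
  simp only [span, SetLike.mem_coe, Submodule.mem_iInf]
  exact fun I hI => hI hs

theorem span_le {P : Operad.{u, w} k} {N : Type} [Finite N] {S : Set (P.obj N)} {I : P.Ideal}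
    (h : S ⊆ I.carrier N) (A : Type) [Finite A] : (P.span S).carrier A ≤ I.carrier A :=
  iInf₂_le I h

section Quotient

variable {P : Operad.{u, v} k} {Q : Operad.{u, w} k}

/-- The projection to a quotient as a morphism. -/
def mkHom (P : Operad.{u, w} k) (I : P.Ideal) : Hom P (P.quotient I) where
  app A _ := P.mkQ I A
  map_relabel _ _ := rfl
  map_one := rfl
  map_comp _ _ := rfl

theorem mkQ_surjective (I : P.Ideal) {A : Type} [Finite A] :
    Function.Surjective (P.mkQ I A) :=
  Submodule.Quotient.mk_surjective _

theorem mkQ_eq_zero (I : P.Ideal) {A : Type} [Finite A] {p : P.obj A} :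
    P.mkQ I A p = 0 ↔ p ∈ I.carrier A :=
  Submodule.Quotient.mk_eq_zero _

/-- The morphism on a quotient that is induced by a morphism which vanishes on the ideal. -/
def Hom.lift (φ : Hom P Q) (I : P.Ideal)
    (h : ∀ (A : Type) [Finite A], I.carrier A ≤ φ.ker.carrier A) : Hom (P.quotient I) Q where
  app A _ := (I.carrier A).liftQ (φ.app A) (h A)
  map_relabel e p := by
    obtain ⟨p, rfl⟩ := Submodule.Quotient.mk_surjective _ p
    exact φ.map_relabel e p
  map_one := φ.map_one
  map_comp p q := by
    obtain ⟨p, rfl⟩ := Submodule.Quotient.mk_surjective _ p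
    obtain ⟨q, rfl⟩ := Submodule.Quotient.mk_surjective _ q
    exact φ.map_comp p q

/-- The morphism on the quotient by the ideal generated by `S` that is induced by a morphism which
vanishes on `S`. -/
def Hom.liftSpan (φ : Hom P Q) {N : Type} [Finite N] (S : Set (P.obj N))
    (h : ∀ s ∈ S, φ.app N s = 0) : Hom (P.quotient (P.span S)) Q :=
  φ.lift _ fun _ _ => span_le (I := φ.ker) (fun s hs => LinearMap.mem_ker.2 (h s hs)) _

end Quotient

/-! ### Composites of binary operations and their symmetries. -/

section Composites

variable (P : Operad.{u, w} k)

theorem relabel_relabel {A B C : Type} [Finite A] [Finite B] [Finite C] (e : A ≃ B) (f : B ≃ C)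
    (p : P.obj A) : P.relabel f (P.relabel e p) = P.relabel (e.trans f) p :=
  (P.relabel_trans e f p).symm

theorem relabel_symm_relabel {A B : Type} [Finite A] [Finite B] (e : A ≃ B) (p : P.obj A) :
    P.relabel e.symm (P.relabel e p) = p := by
  rw [relabel_relabel, Equiv.self_trans_symm, P.relabel_refl]

theorem relabel_relabel_symm {A B : Type} [Finite A] [Finite B] (e : A ≃ B) (p : P.obj B) :
    P.relabel e (P.relabel e.symm p) = p := by
  rw [relabel_relabel, Equiv.symm_trans_self, P.relabel_refl]

theorem comp_relabel_left {A A' B : Type} [Finite A] [Finite A'] [Finite B] (e : A ≃ A')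
    (p : P.obj (Option A)) (q : P.obj B) :
    P.comp (P.relabel (Equiv.optionCongr e) p) q =
      P.relabel (Equiv.sumCongr e (Equiv.refl B)) (P.comp p q) := by
  rw [← P.comp_relabel, P.relabel_refl]

theorem comp_relabel_right {A B B' : Type} [Finite A] [Finite B] [Finite B'] (f : B ≃ B')
    (p : P.obj (Option A)) (q : P.obj B) :
    P.comp p (P.relabel f q) =
      P.relabel (Equiv.sumCongr (Equiv.refl A) f) (P.comp p q) := by
  rw [← P.comp_relabel, Equiv.optionCongr_refl, P.relabel_refl]

theorem op₂_relabel {A A' B B' : Type} [Finite A] [Finite A'] [Finite B] [Finite B'] (e : A ≃ A')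
    (f : B ≃ B') (p : P.obj (Fin 2)) (x : P.obj A) (y : P.obj B) :
    P.op₂ p (P.relabel e x) (P.relabel f y) =
      P.relabel (Equiv.sumCongr e f) (P.op₂ p x y) := by
  unfold op₂
  have h : (Equiv.sumCongr (Equiv.refl Unit) e).trans (unitSumOptionEquiv A') =
      (unitSumOptionEquiv A).trans (Equiv.optionCongr e) := by
    refine Equiv.ext ?_; rintro (a | a) <;> rfl
  rw [comp_relabel_right P e, relabel_relabel, ← P.comp_relabel, relabel_relabel, h]

/-- Exchanging the inputs of p exchanges the order of the two insertions, and insertions into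
different inputs commute by parallel associativity. -/
theorem op₂_swap {A B : Type} [Finite A] [Finite B] (p : P.obj (Fin 2)) (x : P.obj A)
    (y : P.obj B) :
    P.op₂ (P.relabel (Equiv.swap 0 1) p) x y = P.relabel (Equiv.sumComm B A) (P.op₂ p y x) := by
  -- `comp_par` needs both inputs of p as added points, so `Fin 2` is presented as `Option (Option
  -- Empty)` and the superfluous `Empty` is removed afterwards.
  have key : ∀ {A B : Type} [Finite A] [Finite B] (p : P.obj (Fin 2)) (x : P.obj A) (y : P.obj B),
      P.op₂ p x y = P.relabel (Equiv.sumCongr (Equiv.emptySum Empty A) (Equiv.refl B))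
        (P.comp (P.relabel (optionSumEquiv Empty A) (P.comp (P.relabel
          (finTwoOptionEquiv.trans (Equiv.optionCongr unitOptionEmptyEquiv)) p) x)) y) := by
    intro A B _ _ p x y
    have h : ((Equiv.sumCongr unitOptionEmptyEquiv (Equiv.refl A)).trans
        (optionSumEquiv Empty A)).trans (Equiv.optionCongr (Equiv.emptySum Empty A)) =
        unitSumOptionEquiv A := by
      refine Equiv.ext ?_; rintro (a | a) <;> rfl
    rw [← P.comp_relabel_left, ← relabel_relabel P finTwoOptionEquiv,
      comp_relabel_left P unitOptionEmptyEquiv,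
      relabel_relabel, relabel_relabel, op₂, ← Equiv.trans_assoc, h]
  have h₁ : (sumRightCommEquiv Empty B A).trans
      (Equiv.sumCongr (Equiv.emptySum Empty A) (Equiv.refl B)) =
      (Equiv.sumCongr (Equiv.emptySum Empty B) (Equiv.refl A)).trans (Equiv.sumComm B A) := by
    refine Equiv.ext ?_; rintro ((a | a) | a) <;> [exact a.elim; rfl; rfl]
  have h₂ : ((Equiv.swap 0 1).trans (finTwoOptionEquiv.trans
      (Equiv.optionCongr unitOptionEmptyEquiv))).trans (optionSwapEquiv Empty) =
      finTwoOptionEquiv.trans (Equiv.optionCongr unitOptionEmptyEquiv) := by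
    refine Equiv.ext fun i => ?_; fin_cases i <;> rfl
  rw [key, key, P.comp_par]
  simp only [relabel_relabel, h₁, h₂]

/-- The numbering of the leaves of the tree `(∗ ∗) ∗` from the left to the right. -/
def leafEquiv : (Unit ⊕ Unit) ⊕ Unit ≃ Fin 3 where
  toFun
    | .inl (.inl _) => 0
    | .inl (.inr _) => 1
    | .inr _ => 2
  invFun i := if i = 0 then .inl (.inl ()) else if i = 1 then .inl (.inr ()) else .inr ()
  left_inv := by rintro ((a | a) | a) <;> rfl
  right_inv := by decide

/-- The composite `p(q(x₁, x₂), x₃)` of two binary operations. -/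
def leftComp : P.obj (Fin 2) →ₗ[k] P.obj (Fin 2) →ₗ[k] P.obj (Fin 3) :=
  LinearMap.mk₂ k (fun p q => P.relabel leafEquiv (P.op₂ p (P.op₂ q P.one P.one) P.one))
    (by intros; simp only [op₂, map_add, LinearMap.add_apply])
    (by intros; simp only [op₂, map_smul, LinearMap.smul_apply])
    (by intros; simp only [op₂, map_add, LinearMap.add_apply])
    (by intros; simp only [op₂, map_smul, LinearMap.smul_apply])

theorem leftComp_apply (p q : P.obj (Fin 2)) :
    P.leftComp p q = P.relabel leafEquiv (P.op₂ p (P.op₂ q P.one P.one) P.one) := rfl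

theorem leftComp_swap (p q : P.obj (Fin 2)) :
    P.leftComp p (P.relabel (Equiv.swap 0 1) q) =
      P.relabel (Equiv.swap 0 1) (P.leftComp p q) := by
  have h := P.op₂_relabel (Equiv.sumComm Unit Unit) (Equiv.refl Unit) p (P.op₂ q P.one P.one) P.one
  rw [P.relabel_refl] at h
  have h' : (Equiv.sumCongr (Equiv.sumComm Unit Unit) (Equiv.refl Unit)).trans leafEquiv =
      leafEquiv.trans (Equiv.swap 0 1) := by
    refine Equiv.ext ?_; rintro ((a | a) | a) <;> rfl
  rw [leftComp_apply, leftComp_apply, op₂_swap, h, relabel_relabel, relabel_relabel, h']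

theorem Hom.map_leftComp {P : Operad.{u, v} k} {Q : Operad.{u, w} k} (φ : Hom P Q)
    (p q : P.obj (Fin 2)) :
    φ.app (Fin 3) (P.leftComp p q) = Q.leftComp (φ.app _ p) (φ.app _ q) := by
  simp only [leftComp_apply, φ.map_relabel, φ.map_op₂, φ.map_one]

end Composites

/-! ### Ideals of a connected operad in and below the arity of their generators. -/

section Truncation

/-- An operad is connected if it has no operations without inputs and only the multiples
of the unit as operations with one input. -/
structure IsConnected (P : Operad.{u, w} k) : Prop where
  eq_zero : ∀ {A : Type} [Finite A] [IsEmpty A] (p : P.obj A), p = 0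
  eq_smul_one : ∀ p : P.obj Unit, ∃ c : k, p = c • P.one

theorem IsConnected.quotient {P : Operad.{u, w} k} (hP : P.IsConnected) (I : P.Ideal) :
    (P.quotient I).IsConnected where
  eq_zero p := by
    obtain ⟨p, rfl⟩ := mkQ_surjective I p
    rw [hP.eq_zero p, map_zero]
  eq_smul_one p := by
    obtain ⟨p, rfl⟩ := mkQ_surjective I p
    obtain ⟨c, rfl⟩ := hP.eq_smul_one p
    exact ⟨c, by rw [map_smul]; rfl⟩

variable {P : Operad.{u, w} k}

theorem IsConnected.eq_smul_relabel_one (hP : P.IsConnected) {A : Type} [Finite A] (e : Unit ≃ A)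
    (p : P.obj A) : ∃ c : k, p = c • P.relabel e P.one := by
  obtain ⟨c, hc⟩ := hP.eq_smul_one (P.relabel e.symm p)
  exact ⟨c, by rw [← map_smul, ← hc, relabel_relabel_symm]⟩

/-- In a connected operad, the elements that vanish in arities below `|N|` and lie, after any
relabelling by `N`, in a given subspace form an ideal. -/
def IsConnected.truncation (hP : P.IsConnected) {N : Type} [Finite N]
    (M : Submodule k (P.obj N)) : P.Ideal where
  carrier A _ :=
    { carrier := {p | (Nat.card A < Nat.card N → p = 0) ∧ ∀ e : A ≃ N, P.relabel e p ∈ M}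
      add_mem' := fun hp hq => ⟨fun h => by rw [hp.1 h, hq.1 h, add_zero], fun e => by
        rw [map_add]; exact M.add_mem (hp.2 e) (hq.2 e)⟩
      zero_mem' := ⟨fun _ => rfl, fun e => by rw [map_zero]; exact M.zero_mem⟩
      smul_mem' := fun c p hp => ⟨fun h => by rw [hp.1 h, smul_zero], fun e => by
        rw [map_smul]; exact M.smul_mem c (hp.2 e)⟩ }
  relabel_mem e p hp := ⟨fun h => by rw [hp.1 ((Nat.card_congr e).trans_lt h), map_zero],
    fun f => by rw [relabel_relabel]; exact hp.2 _⟩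
  comp_mem_left {A B _ _ p} q hp := by
    -- Only an operation without inputs could lower the arity, and connectedness excludes it.
    rcases isEmpty_or_nonempty B with hB | hB
    · rw [hP.eq_zero q, map_zero]
      exact ⟨fun _ => rfl, fun e => by rw [map_zero]; exact M.zero_mem⟩
    have hB : 0 < Nat.card B := Nat.card_pos
    have hA : Nat.card (Option A) = Nat.card A + 1 := Finite.card_option
    have hAB : Nat.card (A ⊕ B) = Nat.card A + Nat.card B := Nat.card_sum
    refine ⟨fun h => ?_, fun e => ?_⟩
    · rw [hp.1 (by omega), map_zero, LinearMap.zero_apply]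
    · have he := Nat.card_congr e
      -- If q has at least two inputs, then p lies below the critical arity and vanishes. Otherwise
      -- q is a multiple of the unit, and the composite is a relabelling of a multiple of p.
      rcases Nat.lt_or_ge 1 (Nat.card B) with h | h
      · rw [hp.1 (by omega), map_zero, LinearMap.zero_apply, map_zero]
        exact M.zero_mem
      · obtain ⟨f⟩ : Nonempty (Unit ≃ B) :=
          (Finite.card_eq).1 (by rw [Nat.card_unique]; omega)
        obtain ⟨c, rfl⟩ := hP.eq_smul_relabel_one f q
        have h1 : P.comp p P.one = P.relabel (Equiv.optionEquivSumPUnit A) p := by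
          conv_rhs => rw [← P.comp_one p, relabel_relabel, Equiv.symm_trans_self, P.relabel_refl]
        rw [map_smul, map_smul, comp_relabel_right, h1, relabel_relabel, relabel_relabel]
        exact M.smul_mem c (hp.2 _)
  comp_mem_right {A B _ _} p {q} hq := by
    have hAB : Nat.card (A ⊕ B) = Nat.card A + Nat.card B := Nat.card_sum
    refine ⟨fun h => ?_, fun e => ?_⟩
    · rw [hq.1 (by omega), map_zero]
    · have he := Nat.card_congr e
      -- The same dichotomy for the outer factor: either p is unary, hence a multiple of the unit,
      -- or q has too few inputs and vanishes.
      rcases isEmpty_or_nonempty A with hA | hA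
      · obtain ⟨c, rfl⟩ := hP.eq_smul_relabel_one
          (unitOptionEmptyEquiv.trans (Equiv.optionCongr (Equiv.equivOfIsEmpty Empty A))) p
        have h1 : P.comp (P.relabel unitOptionEmptyEquiv P.one) q =
            P.relabel (Equiv.emptySum Empty B).symm q := by
          conv_rhs => rw [← P.one_comp q, relabel_symm_relabel]
        rw [map_smul, LinearMap.smul_apply, map_smul, ← relabel_relabel, comp_relabel_left, h1,
          relabel_relabel, relabel_relabel]
        exact M.smul_mem c (hq.2 _)
      · have : 0 < Nat.card A := Nat.card_pos
        rw [hq.1 (by omega), map_zero, map_zero]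
        exact M.zero_mem

/-- In the arity of its generators an ideal of a connected operad contains nothing beyond linear
combinations of relabelled generators. This bounds an ideal by a linear check on the generators. -/
theorem IsConnected.span_le_of_relabel_mem (hP : P.IsConnected) {N : Type} [Finite N]
    {S : Set (P.obj N)} {M : Submodule k (P.obj N)}
    (h : ∀ s ∈ S, ∀ σ : N ≃ N, P.relabel σ s ∈ M) : (P.span S).carrier N ≤ M := by
  intro p hp
  have := (span_le (I := hP.truncation M)
    (fun s hs => ⟨fun h => (lt_irrefl _ h).elim, h s hs⟩) N hp).2 (Equiv.refl N)
  rwa [P.relabel_refl] at this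

theorem IsConnected.span_eq_bot (hP : P.IsConnected) {N : Type} [Finite N] (S : Set (P.obj N))
    {A : Type} [Finite A] (hA : Nat.card A < Nat.card N) : (P.span S).carrier A = ⊥ :=
  (Submodule.eq_bot_iff _).2 fun _ hp => (span_le (I := hP.truncation ⊤)
    (fun _ _ => ⟨fun h => (lt_irrefl _ h).elim, fun _ => Submodule.mem_top⟩) A hp).1 hA

theorem IsConnected.span_submodule (hP : P.IsConnected) {N : Type} [Finite N]
    {M : Submodule k (P.obj N)} (h : ∀ σ : N ≃ N, ∀ s ∈ M, P.relabel σ s ∈ M) :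
    (P.span (M : Set (P.obj N))).carrier N = M :=
  le_antisymm (hP.span_le_of_relabel_mem fun s hs σ => h σ s hs) (P.subset_span _)

end Truncation

end Operad

open Operad

/-! ### Linear spans of operads of sets. -/

namespace SetOperad

variable {k : Type u} [CommRing k] (S : SetOperad.{w})

@[simp] theorem relabel_single {A B : Type} [Finite A] [Finite B] (e : A ≃ B) (s : S.obj A) :
    (S.linearize k).relabel e (S.single k s) = S.single k (S.relabel e s) :=
  Finsupp.mapDomain_single

@[simp] theorem comp_single {A B : Type} [Finite A] [Finite B] (s : S.obj (Option A))
    (t : S.obj B) :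
    (S.linearize k).comp (S.single k s) (S.single k t) = S.single k (S.comp s t) := by
  have h : Finsupp.linearCombination k (fun p => (Finsupp.lmapDomain k k (S.comp p) :
      (S.obj B →₀ k) →ₗ[k] (S.obj (A ⊕ B) →₀ k))) (Finsupp.single s 1) (Finsupp.single t 1) =
      Finsupp.single (S.comp s t) 1 := by simp
  exact h

theorem one_eq_single : (S.linearize k).one = S.single k S.one := rfl

theorem linearize_hom_ext {A : Type} [Finite A] {M : Type*} [AddCommGroup M] [Module k M]
    {f g : (S.linearize k).obj A →ₗ[k] M} (h : ∀ s : S.obj A, f (S.single k s) = g (S.single k s)) :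
    f = g :=
  Finsupp.lhom_ext' fun s => LinearMap.ext_ring (h s)

theorem mem_of_single {A : Type} [Finite A] {M : Submodule k ((S.linearize k).obj A)}
    (h : ∀ s, S.single k s ∈ M) (p : (S.linearize k).obj A) : p ∈ M := by
  refine Finsupp.induction_linear (motive := fun p => p ∈ M) p M.zero_mem
    (fun _ _ => M.add_mem) fun s c => ?_
  rw [show Finsupp.single s c = c • S.single k s from (Finsupp.smul_single_one s c).symm]
  exact M.smul_mem c (h s)

theorem linearize_isConnected (h₀ : ∀ (A : Type) [Finite A] [IsEmpty A], IsEmpty (S.obj A))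
    (h₁ : ∀ s : S.obj Unit, s = S.one) : (S.linearize k).IsConnected where
  eq_zero {A} _ _ p := by
    have := h₀ A
    exact Subsingleton.elim (α := S.obj A →₀ k) p 0
  eq_smul_one p := by
    have : p ∈ Submodule.span k {(S.linearize k).one} := by
      refine S.mem_of_single (fun s => ?_) p
      rw [h₁ s]
      exact Submodule.mem_span_singleton_self _
    obtain ⟨c, hc⟩ := Submodule.mem_span_singleton.1 this
    exact ⟨c, hc.symm⟩

section

variable {S} {T : SetOperad.{w'}} (F : ∀ (A : Type) [Finite A], S.obj A → T.obj A)

/-- The linear maps of the linear spans that are given by maps of the bases. -/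
def linearizeApp (k : Type u) [CommRing k] (A : Type) [Finite A] :
    (S.linearize k).obj A →ₗ[k] (T.linearize k).obj A :=
  Finsupp.lmapDomain k k (F A)

@[simp] theorem linearizeApp_single {A : Type} [Finite A] (s : S.obj A) :
    linearizeApp F k A (S.single k s) = T.single k (F A s) :=
  Finsupp.mapDomain_single

/-- The morphism of the linear spans that is given by a morphism of operads of sets. -/
def linearizeMap (k : Type u) [CommRing k]
    (h_relabel : ∀ {A B : Type} [Finite A] [Finite B] (e : A ≃ B) (s : S.obj A),
      F B (S.relabel e s) = T.relabel e (F A s)) (h_one : F Unit S.one = T.one)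
    (h_comp : ∀ {A B : Type} [Finite A] [Finite B] (s : S.obj (Option A)) (t : S.obj B),
      F (A ⊕ B) (S.comp s t) = T.comp (F _ s) (F _ t)) :
    Hom (S.linearize k) (T.linearize k) where
  app A _ := linearizeApp F k A
  map_relabel {A B} _ _ e p := by
    have h : linearizeApp F k B ∘ₗ (S.linearize k).relabel e =
        (T.linearize k).relabel e ∘ₗ linearizeApp F k A :=
      linearize_hom_ext S fun s => by
        simp only [LinearMap.comp_apply, relabel_single, linearizeApp_single, h_relabel]
    exact LinearMap.congr_fun h p
  map_one := by rw [one_eq_single, one_eq_single, linearizeApp_single, h_one]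
  map_comp {A B} _ _ p q := by
    have h : (S.linearize k).comp.compr₂ (linearizeApp F k (A ⊕ B)) =
        (T.linearize k).comp.compl₁₂ (linearizeApp F k (Option A)) (linearizeApp F k B) :=
      linearize_hom_ext S fun s => linearize_hom_ext S fun t => by
        simp only [LinearMap.compr₂_apply, LinearMap.compl₁₂_apply, comp_single,
          linearizeApp_single, h_comp]
    exact LinearMap.congr_fun₂ h p q

end

end SetOperad

/-! ### Change of vertex labels, and the shapes of trees with at most three leaves. -/

namespace BinTree

variable {X : Type v} {Y : Type w} {A B : Type}

/-- The tree with every leaf labelled by itself. -/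
def posTree : (t : BinTree X A) → BinTree X t.Pos
  | leaf _ => leaf ()
  | node x l r => node x ((posTree l).bind fun i => leaf (.inl i))
      ((posTree r).bind fun i => leaf (.inr i))

theorem posTree_bind (t : BinTree X A) : (t.posTree.bind fun i => leaf (t.label i)) = t := by
  induction t with
  | leaf a => rfl
  | node x l r hl hr =>
    simp only [posTree, bind, bind_bind, label]
    exact congrArg₂ (node x) hl hr

theorem leaves_relabel (e : A → B) (t : BinTree X A) :
    (t.bind fun a => leaf (X := X) (e a)).leaves = t.leaves.map e := by
  rw [leaves_bind, List.map_eq_flatMap]; rfl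

theorem isMultilinear_posTree (t : BinTree X A) : t.posTree.IsMultilinear := by
  induction t with
  | leaf a => exact ⟨List.nodup_singleton _, fun _ => List.mem_singleton.2 rfl⟩
  | node x l r hl hr =>
    have h : (node x l r).posTree.leaves =
        l.posTree.leaves.map Sum.inl ++ r.posTree.leaves.map Sum.inr :=
      congrArg₂ _ (leaves_relabel _ _) (leaves_relabel _ _)
    rw [IsMultilinear, h]
    refine ⟨List.nodup_append'.2 ⟨hl.1.map Sum.inl_injective, hr.1.map Sum.inr_injective, ?_⟩, ?_⟩
    · intro i h h'
      obtain ⟨a, _, rfl⟩ := List.mem_map.1 h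
      obtain ⟨b, _, hb⟩ := List.mem_map.1 h'
      exact Sum.inr_ne_inl hb
    · rintro (i | i)
      · exact List.mem_append_left _ (List.mem_map_of_mem (hl.2 i))
      · exact List.mem_append_right _ (List.mem_map_of_mem (hr.2 i))

/-- Change of the vertex labels. -/
def mapLabel (f : X → Y) : BinTree X A → BinTree Y A
  | leaf a => leaf a
  | node x l r => node (f x) (mapLabel f l) (mapLabel f r)

theorem mapLabel_bind (f : X → Y) (g : A → BinTree X B) (t : BinTree X A) :
    (t.bind g).mapLabel f = (t.mapLabel f).bind fun a => (g a).mapLabel f := by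
  induction t with
  | leaf a => rfl
  | node x l r hl hr => simp only [bind, mapLabel, hl, hr]

theorem leaves_mapLabel (f : X → Y) (t : BinTree X A) : (t.mapLabel f).leaves = t.leaves := by
  induction t with
  | leaf a => rfl
  | node x l r hl hr => simp only [mapLabel, leaves, hl, hr]

theorem isMultilinear_mapLabel (f : X → Y) {t : BinTree X A} (h : t.IsMultilinear) :
    (t.mapLabel f).IsMultilinear := by
  rwa [IsMultilinear, leaves_mapLabel]

theorem graftAt_mapLabel (f : X → Y) (s : BinTree X B) (o : Option A) :
    (graftAt s o).mapLabel f = graftAt (s.mapLabel f) o := by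
  cases o with
  | none => simp only [graftAt, mapLabel_bind]; rfl
  | some a => rfl

theorem length_leaves_node {x : X} {l r : BinTree X A} : 2 ≤ (node x l r).leaves.length := by
  have hl := List.length_pos_of_ne_nil l.leaves_ne_nil
  have hr := List.length_pos_of_ne_nil r.leaves_ne_nil
  rw [leaves, List.length_append]
  omega

theorem IsMultilinear.length_leaves {t : BinTree X A} (h : t.IsMultilinear) [Finite A] :
    t.leaves.length = Nat.card A := by
  classical
  have := Fintype.ofFinite A
  rw [Nat.card_eq_fintype_card, ← List.toFinset_card_of_nodup h.1, ← Finset.card_univ]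
  congr 1
  ext a
  simp [h.2 a]

theorem eq_leaf_of_length {t : BinTree X A} (h : t.leaves.length = 1) : ∃ a, t = leaf a := by
  cases t with
  | leaf a => exact ⟨a, rfl⟩
  | node x l r =>
    have := length_leaves_node (x := x) (l := l) (r := r)
    omega

theorem eq_node_of_length {t : BinTree X A} (h : t.leaves.length = 2) :
    ∃ x a b, t = node x (leaf a) (leaf b) := by
  cases t with
  | leaf a => simp [leaves] at h
  | node x l r =>
    have hl := List.length_pos_of_ne_nil l.leaves_ne_nil
    have hr := List.length_pos_of_ne_nil r.leaves_ne_nil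
    rw [leaves, List.length_append] at h
    obtain ⟨a, rfl⟩ := eq_leaf_of_length (t := l) (by omega)
    obtain ⟨b, rfl⟩ := eq_leaf_of_length (t := r) (by omega)
    exact ⟨x, a, b, rfl⟩

theorem eq_node_node_of_length {t : BinTree X A} (h : t.leaves.length = 3) :
    ∃ x y a b c, t = node x (node y (leaf a) (leaf b)) (leaf c) ∨
      t = node x (leaf c) (node y (leaf a) (leaf b)) := by
  cases t with
  | leaf a => simp [leaves] at h
  | node x l r =>
    have hl := List.length_pos_of_ne_nil l.leaves_ne_nil
    have hr := List.length_pos_of_ne_nil r.leaves_ne_nil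
    rw [leaves, List.length_append] at h
    rcases Nat.lt_or_ge 1 l.leaves.length with h' | h'
    · obtain ⟨y, a, b, rfl⟩ := eq_node_of_length (t := l) (by omega)
      obtain ⟨c, rfl⟩ := eq_leaf_of_length (t := r) (by omega)
      exact ⟨x, y, a, b, c, .inl rfl⟩
    · obtain ⟨y, a, b, rfl⟩ := eq_node_of_length (t := r) (by omega)
      obtain ⟨c, rfl⟩ := eq_leaf_of_length (t := l) (by omega)
      exact ⟨x, y, a, b, c, .inr rfl⟩

end BinTree

/-! ### The tree operad and the evaluation of trees. -/

variable {k : Type u} [CommRing k] {X : Type v} {Y : Type w}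

theorem treeOperad_isConnected : (treeOperad k X).IsConnected :=
  SetOperad.linearize_isConnected _
    (fun A _ _ => ⟨fun t => t.1.leaves_ne_nil (List.eq_nil_iff_forall_not_mem.2
      fun a => isEmptyElim a)⟩)
    (fun t => by
      obtain ⟨a, ha⟩ := BinTree.eq_leaf_of_length (t := t.1)
        (by rw [t.2.length_leaves, Nat.card_unique])
      exact Subtype.ext ha)

/-- The tree monomial of a multilinear tree in the tree operad. -/
abbrev treeSingle (k : Type u) [CommRing k] {X : Type v} {A : Type} [Finite A] (t : BinTree X A)
    (h : t.IsMultilinear) : (treeOperad k X).obj A :=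
  (treeSetOperad X).single k (treeMonomial t h)

theorem relabel_treeSingle {A B : Type} [Finite A] [Finite B] (e : A ≃ B) (t : BinTree X A)
    (h : t.IsMultilinear) : (treeOperad k X).relabel e (treeSingle k t h) =
      treeSingle k (t.bind fun a => .leaf (e a)) (BinTree.isMultilinear_relabel e h) :=
  SetOperad.relabel_single _ _ _

/-- The morphism of tree operads given by a map of the labels. -/
def treeMap (k : Type u) [CommRing k] (f : X → Y) : Hom (treeOperad k X) (treeOperad k Y) :=
  SetOperad.linearizeMap (S := treeSetOperad X) (T := treeSetOperad Y)
    (fun _ _ t => ⟨t.1.mapLabel f, BinTree.isMultilinear_mapLabel f t.2⟩) k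
    (fun _ t => Subtype.ext (BinTree.mapLabel_bind f _ t.1))
    rfl
    (fun s t => Subtype.ext ((BinTree.mapLabel_bind f _ s.1).trans
      (congrArg (fun g => BinTree.bind g _) (funext (BinTree.graftAt_mapLabel f t.1)))))

theorem op₂_treeGen {A B : Type} [Finite A] [Finite B] (x : X) (s : BinTree X A)
    (hs : s.IsMultilinear) (t : BinTree X B) (ht : t.IsMultilinear)
    (h : (BinTree.node x (s.bind fun i => .leaf (Sum.inl i))
      (t.bind fun i => .leaf (Sum.inr i))).IsMultilinear) :
    (treeOperad k X).op₂ (treeGen k x) (treeSingle k s hs) (treeSingle k t ht) =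
      treeSingle k (.node x (s.bind fun i => .leaf (.inl i)) (t.bind fun i => .leaf (.inr i))) h := by
  rw [op₂, treeGen, SetOperad.relabel_single, SetOperad.comp_single, SetOperad.relabel_single,
    SetOperad.comp_single]
  refine congrArg _ (Subtype.ext ?_)
  simp [treeSetOperad, treeMonomial, BinTree.bind, BinTree.graftAt, finTwoOptionEquiv,
    unitSumOptionEquiv, BinTree.bind_bind]

theorem eval_treeGen {A : Type} (t : BinTree X A) :
    t.eval (treeOperad k X) (treeGen k) = treeSingle k t.posTree t.isMultilinear_posTree := by
  induction t with
  | leaf a => rfl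
  | node x l r hl hr =>
    rw [BinTree.eval, hl, hr]
    exact op₂_treeGen _ _ _ _ _ _

theorem treeEval_treeSingle (P : Operad.{u, w} k) (f : X → P.obj (Fin 2)) {A : Type} [Finite A]
    (t : BinTree X A) (h : t.IsMultilinear) :
    treeEval P f A (treeSingle k t h) = P.relabel (t.labelEquiv h) (t.eval P f) :=
  (Finsupp.linearCombination_single k 1 _).trans (one_smul k _)

/-- Evaluating a tree at the generators themselves rebuilds it with its leaves labelled by their
positions, and the final relabelling restores the variables. Hence a tree is a composite of
generators, and morphisms are determined by their values on these. -/
theorem treeEval_treeGen (A : Type) [Finite A] (p : (treeOperad k X).obj A) :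
    treeEval (treeOperad k X) (treeGen k) A p = p := by
  refine LinearMap.congr_fun (g := LinearMap.id) ?_ p
  refine SetOperad.linearize_hom_ext _ fun t => ?_
  refine (treeEval_treeSingle _ _ t.1 t.2).trans ?_
  rw [eval_treeGen, relabel_treeSingle]
  exact congrArg _ (Subtype.ext t.1.posTree_bind)

theorem Operad.Hom.map_eval {P : Operad.{u, w} k} {Q : Operad.{u, w'} k} (φ : Hom P Q)
    (f : X → P.obj (Fin 2)) {A : Type} (t : BinTree X A) :
    φ.app _ (t.eval P f) = t.eval Q fun x => φ.app _ (f x) := by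
  induction t with
  | leaf a => exact φ.map_one
  | node x l r hl hr =>
    rw [BinTree.eval, BinTree.eval, ← hl, ← hr]
    exact φ.map_op₂ _ _ _

theorem Operad.Hom.map_treeEval {P : Operad.{u, w} k} {Q : Operad.{u, w'} k} (φ : Hom P Q)
    (f : X → P.obj (Fin 2)) {A : Type} [Finite A] (p : (treeOperad k X).obj A) :
    φ.app A (treeEval P f A p) = treeEval Q (fun x => φ.app _ (f x)) A p := by
  refine LinearMap.congr_fun (f := φ.app A ∘ₗ treeEval P f A) ?_ p
  refine SetOperad.linearize_hom_ext _ fun t => ?_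
  refine (congrArg (φ.app A) (treeEval_treeSingle _ _ t.1 t.2)).trans
    (Eq.trans ?_ (treeEval_treeSingle _ _ t.1 t.2).symm)
  rw [φ.map_relabel, φ.map_eval]

/-- A morphism from a tree operad is determined by its values on the generators. -/
theorem Operad.Hom.app_eq_treeEval {Q : Operad.{u, w'} k} (φ : Hom (treeOperad k X) Q)
    {A : Type} [Finite A] (p : (treeOperad k X).obj A) :
    φ.app A p = treeEval Q (fun x => φ.app _ (treeGen k x)) A p := by
  rw [← φ.map_treeEval, treeEval_treeGen]

theorem Operad.Hom.tree_ext {Q : Operad.{u, w'} k} {φ ψ : Hom (treeOperad k X) Q}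
    (h : ∀ x, φ.app _ (treeGen k x) = ψ.app _ (treeGen k x)) {A : Type} [Finite A]
    (p : (treeOperad k X).obj A) : φ.app A p = ψ.app A p := by
  rw [φ.app_eq_treeEval, ψ.app_eq_treeEval, funext h]

@[simp] theorem treeMap_treeGen (f : X → Y) (x : X) :
    (treeMap k f).app _ (treeGen k x) = treeGen k (f x) :=
  Finsupp.mapDomain_single

theorem treeEval_left (P : Operad.{u, w} k) (f : X → P.obj (Fin 2)) (x y : X) (a b c : Fin 3)
    (h : (BinTree.node x (.node y (.leaf a) (.leaf b)) (.leaf c)).IsMultilinear) :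
    treeEval P f (Fin 3) (treeSingle k _ h) =
      P.relabel (leafEquiv.symm.trans (BinTree.labelEquiv _ h)) (P.leftComp (f x) (f y)) := by
  have key : ∀ e : (Unit ⊕ Unit) ⊕ Unit ≃ Fin 3,
      P.relabel e (P.op₂ (f x) (P.op₂ (f y) P.one P.one) P.one) =
        P.relabel (leafEquiv.symm.trans e) (P.leftComp (f x) (f y)) := by
    intro e
    rw [leftComp_apply, relabel_relabel, ← Equiv.trans_assoc, Equiv.self_trans_symm,
      Equiv.refl_trans]
  exact (treeEval_treeSingle _ _ _ _).trans (key _)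

/-- The right comb becomes a left comb by `op₂_swap` at the root, which costs a transposition of the
root operation. No separate right composites are needed. -/
theorem treeEval_right (P : Operad.{u, w} k) (f : X → P.obj (Fin 2)) (x y : X) (a b c : Fin 3)
    (h : (BinTree.node x (.leaf c) (.node y (.leaf a) (.leaf b))).IsMultilinear) :
    treeEval P f (Fin 3) (treeSingle k _ h) =
      P.relabel (leafEquiv.symm.trans ((Equiv.sumComm (Unit ⊕ Unit) Unit).trans
        (BinTree.labelEquiv _ h))) (P.leftComp (P.relabel (Equiv.swap 0 1) (f x)) (f y)) := by
  have key : ∀ e : Unit ⊕ (Unit ⊕ Unit) ≃ Fin 3,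
      P.relabel e (P.op₂ (f x) P.one (P.op₂ (f y) P.one P.one)) =
        P.relabel (leafEquiv.symm.trans ((Equiv.sumComm (Unit ⊕ Unit) Unit).trans e))
          (P.leftComp (P.relabel (Equiv.swap 0 1) (f x)) (f y)) := by
    intro e
    rw [leftComp_apply, relabel_relabel, op₂_swap, relabel_relabel]
    refine congrArg (fun e => P.relabel e _) (Equiv.ext ?_)
    rintro (i | (i | i)) <;> rfl
  exact (treeEval_treeSingle _ _ _ _).trans (key _)

theorem treeEval_relabel_treeLeft (P : Operad.{u, w} k) (f : X → P.obj (Fin 2)) (x y : X)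
    (σ : Equiv.Perm (Fin 3)) :
    treeEval P f (Fin 3) ((treeOperad k X).relabel σ (treeLeft k x y)) =
      P.relabel σ (P.leftComp (f x) (f y)) := by
  rw [treeLeft, relabel_treeSingle]
  refine (treeEval_left P f x y (σ 0) (σ 1) (σ 2) _).trans ?_
  refine congrArg (fun e => P.relabel e _) (Equiv.ext fun i => ?_)
  fin_cases i <;> rfl

theorem exists_treeEval_eq (P : Operad.{u, w} k) (f : X → P.obj (Fin 2))
    (t : (treeSetOperad X).obj (Fin 3)) :
    ∃ (x y : X) (σ : Equiv.Perm (Fin 3)),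
      treeEval P f (Fin 3) ((treeSetOperad X).single k t) =
        P.relabel σ (P.leftComp (f x) (f y)) ∨
      treeEval P f (Fin 3) ((treeSetOperad X).single k t) =
        P.relabel σ (P.leftComp (P.relabel (Equiv.swap 0 1) (f x)) (f y)) := by
  obtain ⟨t, h⟩ := t
  obtain ⟨x, y, a, b, c, rfl | rfl⟩ :=
    BinTree.eq_node_node_of_length (t := t) (by rw [h.length_leaves, Nat.card_fin])
  · exact ⟨x, y, _, .inl (treeEval_left P f x y a b c h)⟩
  · exact ⟨x, y, _, .inr (treeEval_right P f x y a b c h)⟩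

theorem exists_relabel_treeGen (t : (treeSetOperad X).obj (Fin 2)) :
    ∃ (x : X) (σ : Equiv.Perm (Fin 2)),
      (treeSetOperad X).single k t = (treeOperad k X).relabel σ (treeGen k x) := by
  obtain ⟨t, h⟩ := t
  obtain ⟨x, a, b, rfl⟩ :=
    BinTree.eq_node_of_length (t := t) (by rw [h.length_leaves, Nat.card_fin])
  have hab : a ≠ b := by
    rintro rfl
    simpa [BinTree.leaves] using h.1
  have key : ∃ σ : Equiv.Perm (Fin 2), σ 0 = a ∧ σ 1 = b := by
    clear h
    revert a b
    decide
  obtain ⟨σ, rfl, rfl⟩ := key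
  exact ⟨x, σ, (relabel_treeSingle σ _ (BinTree.isMultilinear_gen x)).symm⟩

/-! ### The free operad in arities two and three. -/

section Free

variable {k : Type u} [CommRing k] {V : Type v} [AddCommGroup V] [Module k V]
  (ρ : Representation k (Equiv.Perm (Fin 2)) V)

theorem freeOperad_isConnected : (freeOperad ρ).IsConnected :=
  treeOperad_isConnected.quotient _

theorem freeMk_surjective (A : Type) [Finite A] : Function.Surjective (freeMk ρ A) :=
  mkQ_surjective _

/-- The projection from tree monomials to the free operad as a morphism. -/
def freeHom : Hom (treeOperad k V) (freeOperad ρ) :=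
  mkHom _ _

theorem freeHom_app (A : Type) [Finite A] (p : (treeOperad k V).obj A) :
    (freeHom ρ).app A p = freeMk ρ A p := rfl

theorem freeMk_eq_zero {p : (treeOperad k V).obj (Fin 2)} (h : p ∈ generatorRelations ρ) :
    freeMk ρ (Fin 2) p = 0 :=
  (mkQ_eq_zero _).2 (subset_span _ _ h)

theorem freeGen_relabel (σ : Equiv.Perm (Fin 2)) (x : V) :
    freeGen ρ (ρ σ x) = (freeOperad ρ).relabel σ (freeGen ρ x) := by
  have h := freeMk_eq_zero ρ (Or.inr ⟨σ, x, rfl⟩)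
  rw [map_sub, sub_eq_zero] at h
  exact h

/-- The generators of the free operad as a linear function of `v`. -/
def freeGenₗ : V →ₗ[k] (freeOperad ρ).obj (Fin 2) where
  toFun := freeGen ρ
  map_add' x y := by
    have h := freeMk_eq_zero ρ (Or.inl (Or.inl ⟨x, y, rfl⟩))
    rw [map_sub, map_sub, sub_sub, sub_eq_zero] at h
    exact h
  map_smul' c x := by
    have h := freeMk_eq_zero ρ (Or.inl (Or.inr ⟨c, x, rfl⟩))
    rw [map_sub, sub_eq_zero, map_smul] at h
    exact h

theorem freeGenₗ_apply (x : V) : freeGenₗ ρ x = freeGen ρ x := rfl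

/-- A morphism from the free operad, given by a morphism from the tree operad whose values on the
generators depend linearly and equivariantly on the labels. -/
def freeLift {Q : Operad.{u, w} k} (Φ : Hom (treeOperad k V) Q) (g : V →ₗ[k] Q.obj (Fin 2))
    (h : ∀ x, Φ.app _ (treeGen k x) = g x) (hg : ∀ σ x, g (ρ σ x) = Q.relabel σ (g x)) :
    Hom (freeOperad ρ) Q :=
  Φ.liftSpan (generatorRelations ρ) (by
    rintro _ ((⟨x, y, rfl⟩ | ⟨c, x, rfl⟩) | ⟨σ, x, rfl⟩)
    · simp only [map_sub, h, map_add]; abel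
    · simp only [map_sub, h, map_smul, sub_self]
    · rw [map_sub, Φ.map_relabel, h, h, hg, sub_self])

theorem perm_fin_two (σ : Equiv.Perm (Fin 2)) : σ = 1 ∨ σ = Equiv.swap 0 1 := by
  revert σ; decide

/-- The value of a tree with two leaves in the `S₂`-module of its labels. -/
def BinTree.corollaValue : BinTree V (Fin 2) → V
  | .node x (.leaf a) _ => if a = 0 then x else ρ (Equiv.swap 0 1) x
  -- The default is harmless: a multilinear tree on two variables has two leaves, so it has the
  -- preceding shape, and its second leaf is determined by the first.
  | _ => 0

/-- The linear extension of `BinTree.corollaValue`. -/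
def treeValue : (treeOperad k V).obj (Fin 2) →ₗ[k] V :=
  Finsupp.linearCombination k fun t : {t : BinTree V (Fin 2) // t.IsMultilinear} =>
    t.1.corollaValue ρ

theorem treeValue_relabel_treeGen (σ : Equiv.Perm (Fin 2)) (x : V) :
    treeValue ρ ((treeOperad k V).relabel σ (treeGen k x)) = ρ σ x := by
  rw [treeGen, relabel_treeSingle]
  refine (Finsupp.linearCombination_single k 1 _).trans ((one_smul k _).trans ?_)
  rcases perm_fin_two σ with rfl | rfl <;> simp [treeMonomial, BinTree.corollaValue, BinTree.bind]

theorem treeValue_treeGen (x : V) : treeValue ρ (treeGen k x) = x := by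
  have h := treeValue_relabel_treeGen ρ 1 x
  rwa [map_one, Module.End.one_apply, Equiv.Perm.one_def, relabel_refl] at h

/-- The ideal is generated in arity two, so it suffices that `treeValue` kills all relabellings of
the generating relations. As `treeValue` recovers v from its generator, V embeds into 𝓕_V(2). -/
theorem generatorIdeal_le : (generatorIdeal ρ).carrier (Fin 2) ≤ LinearMap.ker (treeValue ρ) := by
  refine treeOperad_isConnected.span_le_of_relabel_mem ?_
  rintro _ ((⟨x, y, rfl⟩ | ⟨c, x, rfl⟩) | ⟨τ, x, rfl⟩) (σ : Equiv.Perm (Fin 2))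
  · simp only [LinearMap.mem_ker, map_sub, treeValue_relabel_treeGen, map_add]; abel
  · simp only [LinearMap.mem_ker, map_sub, treeValue_relabel_treeGen, map_smul, sub_self]
  · rw [LinearMap.mem_ker, map_sub, relabel_relabel, map_sub, treeValue_relabel_treeGen,
      show τ.trans σ = σ * τ from rfl, treeValue_relabel_treeGen, map_mul]
    exact sub_self _

theorem freeGenₗ_injective : Function.Injective (freeGenₗ ρ) := by
  rw [injective_iff_map_eq_zero]
  intro x hx
  have h := generatorIdeal_le ρ ((mkQ_eq_zero _).1 hx)
  rwa [LinearMap.mem_ker, treeValue_treeGen] at h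

theorem freeGenₗ_surjective : Function.Surjective (freeGenₗ ρ) := by
  intro p
  obtain ⟨p, rfl⟩ := freeMk_surjective ρ _ p
  refine SetOperad.mem_of_single (treeSetOperad V)
    (M := (LinearMap.range (freeGenₗ ρ)).comap (freeMk ρ (Fin 2))) (fun t => ?_) p
  obtain ⟨x, σ, h⟩ := exists_relabel_treeGen (k := k) t
  exact ⟨ρ σ x, by rw [h]; exact freeGen_relabel ρ σ x⟩

/-- The binary operations of the free operad. -/
def freeEquiv : V ≃ₗ[k] (freeOperad ρ).obj (Fin 2) :=
  LinearEquiv.ofBijective (freeGenₗ ρ) ⟨freeGenₗ_injective ρ, freeGenₗ_surjective ρ⟩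

theorem treeEval_freeGen {A : Type} [Finite A] (p : (treeOperad k V).obj A) :
    treeEval (freeOperad ρ) (freeGen ρ) A p = freeMk ρ A p :=
  ((freeHom ρ).app_eq_treeEval p).symm

theorem freeMk_treeLeft (x y : V) :
    freeMk ρ (Fin 3) (treeLeft k x y) = (freeOperad ρ).leftComp (freeGen ρ x) (freeGen ρ y) := by
  have h := treeEval_relabel_treeLeft (freeOperad ρ) (freeGen ρ) x y (Equiv.refl _)
  rwa [relabel_refl, relabel_refl, treeEval_freeGen] at h

theorem leftComp_mem_leftComposites (x y : V) :
    (freeOperad ρ).leftComp (freeGen ρ x) (freeGen ρ y) ∈ leftComposites ρ :=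
  Submodule.subset_span ⟨(x, y), freeMk_treeLeft ρ x y⟩

theorem leftComposites_eq_range : leftComposites ρ = LinearMap.range (TensorProduct.lift
    ((freeOperad ρ).leftComp.compl₁₂ (freeGenₗ ρ) (freeGenₗ ρ))) := by
  refine le_antisymm (Submodule.span_le.2 ?_) ?_
  · rintro _ ⟨⟨x, y⟩, rfl⟩
    exact ⟨x ⊗ₜ y, (freeMk_treeLeft ρ x y).symm⟩
  · rintro _ ⟨t, rfl⟩
    induction t with
    | zero => rw [map_zero]; exact Submodule.zero_mem _
    | add s t hs ht => rw [map_add]; exact Submodule.add_mem _ hs ht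
    | tmul x y => exact leftComp_mem_leftComposites ρ x y

theorem leftComposites_le_outerComposites : leftComposites ρ ≤ outerComposites ρ := le_sup_left

theorem relabel_mem_outerComposites {p : (freeOperad ρ).obj (Fin 3)} (hp : p ∈ leftComposites ρ) :
    (freeOperad ρ).relabel (Equiv.swap 0 2) p ∈ outerComposites ρ :=
  Submodule.mem_sup_right (Submodule.mem_map_of_mem hp)

/-- Each tree with three leaves is a relabelled left comb once root transpositions are absorbed into
V. Only this spanning property is used, not the description of 𝓕_V(3) as an induced module. -/
theorem iSup_map_leftComposites :
    ⨆ σ : Equiv.Perm (Fin 3), (leftComposites ρ).map ((freeOperad ρ).relabel σ) = ⊤ := by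
  refine (Submodule.eq_top_iff').2 fun p => ?_
  obtain ⟨p, rfl⟩ := freeMk_surjective ρ _ p
  refine SetOperad.mem_of_single (treeSetOperad V) (M := (⨆ σ : Equiv.Perm (Fin 3),
    (leftComposites ρ).map ((freeOperad ρ).relabel σ)).comap (freeMk ρ (Fin 3))) (fun t => ?_) p
  rw [Submodule.mem_comap, ← treeEval_freeGen]
  obtain ⟨x, y, σ, h | h⟩ := exists_treeEval_eq (freeOperad ρ) (freeGen ρ) t
  · rw [h]
    exact Submodule.mem_iSup_of_mem σ
      (Submodule.mem_map_of_mem (leftComp_mem_leftComposites ρ x y))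
  · rw [h, ← freeGen_relabel]
    exact Submodule.mem_iSup_of_mem σ
      (Submodule.mem_map_of_mem (leftComp_mem_leftComposites ρ _ y))

instance finite_freeOperad_three [Module.Finite k V] :
    Module.Finite k ((freeOperad ρ).obj (Fin 3)) := by
  have h : (leftComposites ρ).FG := by
    rw [leftComposites_eq_range, LinearMap.range_eq_map]
    exact (Module.Finite.fg_top).map _
  refine ⟨?_⟩
  rw [← iSup_map_leftComposites]
  exact Submodule.fg_iSup _ fun σ => h.map _

theorem outerRelations_le {R : Submodule k ((freeOperad ρ).obj (Fin 3))}
    (hR : ∀ (σ : Equiv.Perm (Fin 3)), ∀ r ∈ R, (freeOperad ρ).relabel σ r ∈ R) :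
    outerRelations ρ R ≤ R :=
  iSup_le fun σ => Submodule.map_le_iff_le_comap.2 fun r hr => hR σ r hr.2

theorem relabel_mem_outerRelations {R : Submodule k ((freeOperad ρ).obj (Fin 3))}
    (σ : Equiv.Perm (Fin 3)) {r : (freeOperad ρ).obj (Fin 3)} (h : r ∈ outerRelations ρ R) :
    (freeOperad ρ).relabel σ r ∈ outerRelations ρ R := by
  have : outerRelations ρ R ≤ (outerRelations ρ R).comap ((freeOperad ρ).relabel σ) := by
    refine iSup_le fun τ => Submodule.map_le_iff_le_comap.2 fun r hr => ?_
    rw [Submodule.mem_comap, Submodule.mem_comap, relabel_relabel]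
    exact Submodule.mem_iSup_of_mem (τ.trans σ) (Submodule.mem_map_of_mem hr)
  exact this h

end Free

/-! ### Quadratic operads in arities two and three. -/

section Quadratic

variable {k : Type u} [CommRing k] {V : Type v} [AddCommGroup V] [Module k V]
  (ρ : Representation k (Equiv.Perm (Fin 2)) V) (R : Submodule k ((freeOperad ρ).obj (Fin 3)))

/-- The projection from the free operad to a quadratic operad. -/
def quadraticHom : Hom (freeOperad ρ) (quadraticOperad ρ R) :=
  mkHom _ _

theorem quadraticHom_surjective (A : Type) [Finite A] :
    Function.Surjective ((quadraticHom ρ R).app A) :=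
  mkQ_surjective _

theorem quadraticHom_eq_zero_of_mem {r : (freeOperad ρ).obj (Fin 3)} (h : r ∈ R) :
    (quadraticHom ρ R).app (Fin 3) r = 0 :=
  (mkQ_eq_zero _).2 (subset_span _ _ h)

-- For an S₃-stable R, the ideal generated by R is R itself in arity three.
variable {R} in
theorem quadraticHom_eq_zero
    (hR : ∀ (σ : Equiv.Perm (Fin 3)), ∀ r ∈ R, (freeOperad ρ).relabel σ r ∈ R)
    {r : (freeOperad ρ).obj (Fin 3)} : (quadraticHom ρ R).app (Fin 3) r = 0 ↔ r ∈ R :=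
  (mkQ_eq_zero _).trans (by rw [(freeOperad_isConnected ρ).span_submodule hR])

/-- The binary operations of a quadratic operad. -/
def quadraticEquiv : V ≃ₗ[k] (quadraticOperad ρ R).obj (Fin 2) :=
  (freeEquiv ρ).trans (LinearEquiv.ofBijective ((quadraticHom ρ R).app (Fin 2))
    ⟨(injective_iff_map_eq_zero _).2 fun p hp => by
      have h := (mkQ_eq_zero _).1 hp
      -- The relations live in arity three, so the ideal vanishes in arity two.
      rwa [(freeOperad_isConnected ρ).span_eq_bot _ (by simp), Submodule.mem_bot] at h,
    quadraticHom_surjective ρ R _⟩)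

theorem quadraticEquiv_apply (x : V) :
    quadraticEquiv ρ R x = (quadraticHom ρ R).app (Fin 2) (freeGen ρ x) := rfl

theorem relabel_quadraticEquiv (σ : Equiv.Perm (Fin 2)) (x : V) :
    (quadraticOperad ρ R).relabel σ (quadraticEquiv ρ R x) = quadraticEquiv ρ R (ρ σ x) := by
  rw [quadraticEquiv_apply, quadraticEquiv_apply, freeGen_relabel, Hom.map_relabel]

theorem quadraticEquiv_symm_relabel (σ : Equiv.Perm (Fin 2))
    (p : (quadraticOperad ρ R).obj (Fin 2)) :
    (quadraticEquiv ρ R).symm ((quadraticOperad ρ R).relabel σ p) =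
      ρ σ ((quadraticEquiv ρ R).symm p) := by
  rw [LinearEquiv.symm_apply_eq, ← relabel_quadraticEquiv, LinearEquiv.apply_symm_apply]

variable {R} in
/-- The operations with three inputs of a quadratic operad. -/
def quadraticThreeEquiv
    (hR : ∀ (σ : Equiv.Perm (Fin 3)), ∀ r ∈ R, (freeOperad ρ).relabel σ r ∈ R) :
    (quadraticOperad ρ R).obj (Fin 3) ≃ₗ[k] ((freeOperad ρ).obj (Fin 3) ⧸ R) :=
  Submodule.quotEquivOfEq _ _ ((freeOperad_isConnected ρ).span_submodule hR)

end Quadratic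

/-- Both components are quotients of the same finite-dimensional space, so equal ranks force S and R
to have the same dimension, and S ≤ R then gives equality. -/
theorem rank_quadraticOperad_eq_iff {k : Type u} [Field k] {V : Type v} [AddCommGroup V]
    [Module k V] [FiniteDimensional k V] (ρ : Representation k (Equiv.Perm (Fin 2)) V)
    {R S : Submodule k ((freeOperad ρ).obj (Fin 3))}
    (hR : ∀ (σ : Equiv.Perm (Fin 3)), ∀ r ∈ R, (freeOperad ρ).relabel σ r ∈ R)
    (hS : ∀ (σ : Equiv.Perm (Fin 3)), ∀ r ∈ S, (freeOperad ρ).relabel σ r ∈ S) (h : S ≤ R) :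
    Module.rank k ((quadraticOperad ρ R).obj (Fin 3)) =
      Module.rank k ((quadraticOperad ρ S).obj (Fin 3)) ↔ S = R := by
  refine ⟨fun hr => ?_, fun h => by rw [h]⟩
  rw [(quadraticThreeEquiv ρ hR).rank_eq, (quadraticThreeEquiv ρ hS).rank_eq,
    ← Module.finrank_eq_rank, ← Module.finrank_eq_rank, Nat.cast_inj] at hr
  refine Submodule.eq_of_le_of_finrank_eq h ?_
  have h₁ := R.finrank_quotient_add_finrank
  have h₂ := S.finrank_quotient_add_finrank
  omega

/-! ### Hadamard products with the span of an operad of sets: forgetting words and taking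
coordinates. -/

section Hadamard

variable {k : Type u} [CommRing k]

namespace Operad

variable {P : Operad.{u, v} k} {Q : Operad.{u, w} k} {Q' : Operad.{u, w'} k}

/-- The pure tensors in the Hadamard product. -/
def tensor (P : Operad.{u, v} k) (Q : Operad.{u, w} k) (A : Type) [Finite A] :
    P.obj A →ₗ[k] Q.obj A →ₗ[k] (P.hadamard Q).obj A :=
  TensorProduct.mk k (P.obj A) (Q.obj A)

theorem mem_hadamard_of_tensor {A : Type} [Finite A] {M : Submodule k ((P.hadamard Q).obj A)}
    (h : ∀ p q, tensor P Q A p q ∈ M) (x : (P.hadamard Q).obj A) : x ∈ M :=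
  TensorProduct.induction_on (motive := fun x => x ∈ M) x M.zero_mem h fun _ _ => M.add_mem

theorem hadamard_hom_ext {A : Type} [Finite A] {M : Type*} [AddCommGroup M] [Module k M]
    {f g : (P.hadamard Q).obj A →ₗ[k] M}
    (h : ∀ p q, f (tensor P Q A p q) = g (tensor P Q A p q)) : f = g :=
  LinearMap.ext fun p => mem_hadamard_of_tensor (M := LinearMap.eqLocus f g) h p

/-- The linear map on a component of the Hadamard product that is given by a bilinear map. -/
def tensorLift {A : Type} [Finite A] {M : Type*} [AddCommGroup M] [Module k M]
    (f : P.obj A →ₗ[k] Q.obj A →ₗ[k] M) : (P.hadamard Q).obj A →ₗ[k] M :=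
  TensorProduct.lift f

@[simp] theorem tensorLift_tensor {A : Type} [Finite A] {M : Type*} [AddCommGroup M] [Module k M]
    (f : P.obj A →ₗ[k] Q.obj A →ₗ[k] M) (p : P.obj A) (q : Q.obj A) :
    tensorLift f (tensor P Q A p q) = f p q :=
  TensorProduct.lift.tmul _ _

@[simp] theorem relabel_tensor {A B : Type} [Finite A] [Finite B] (e : A ≃ B) (p : P.obj A)
    (q : Q.obj A) : (P.hadamard Q).relabel e (tensor P Q A p q) =
      tensor P Q B (P.relabel e p) (Q.relabel e q) := rfl

@[simp] theorem comp_tensor {A B : Type} [Finite A] [Finite B] (p : P.obj (Option A))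
    (q : Q.obj (Option A)) (p' : P.obj B) (q' : Q.obj B) :
    (P.hadamard Q).comp (tensor P Q _ p q) (tensor P Q B p' q') =
      tensor P Q _ (P.comp p p') (Q.comp q q') := rfl

theorem one_eq_tensor : (P.hadamard Q).one = tensor P Q Unit P.one Q.one := rfl

theorem leftComp_tensor (p p' : P.obj (Fin 2)) (q q' : Q.obj (Fin 2)) :
    (P.hadamard Q).leftComp (tensor P Q _ p q) (tensor P Q _ p' q') =
      tensor P Q _ (P.leftComp p p') (Q.leftComp q q') := rfl

/-- A morphism from the Hadamard product, given by bilinear maps. -/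
def Hom.ofTensor (f : ∀ (A : Type) [Finite A], P.obj A →ₗ[k] Q.obj A →ₗ[k] Q'.obj A)
    (h_relabel : ∀ {A B : Type} [Finite A] [Finite B] (e : A ≃ B) (p : P.obj A) (q : Q.obj A),
      f B (P.relabel e p) (Q.relabel e q) = Q'.relabel e (f A p q))
    (h_one : f Unit P.one Q.one = Q'.one)
    (h_comp : ∀ {A B : Type} [Finite A] [Finite B] (p : P.obj (Option A)) (q : Q.obj (Option A))
      (p' : P.obj B) (q' : Q.obj B),
      f (A ⊕ B) (P.comp p p') (Q.comp q q') = Q'.comp (f _ p q) (f _ p' q')) :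
    Hom (P.hadamard Q) Q' where
  app A _ := tensorLift (f A)
  map_relabel {A B} _ _ e p := by
    have h : tensorLift (f B) ∘ₗ (P.hadamard Q).relabel e = Q'.relabel e ∘ₗ tensorLift (f A) :=
      hadamard_hom_ext fun p q => by
        simp only [LinearMap.comp_apply, relabel_tensor, tensorLift_tensor, h_relabel]
    exact LinearMap.congr_fun h p
  map_one := by rw [one_eq_tensor, tensorLift_tensor, h_one]
  map_comp {A B} _ _ p q := by
    have h : (P.hadamard Q).comp.compr₂ (tensorLift (f (A ⊕ B))) =
        Q'.comp.compl₁₂ (tensorLift (f (Option A))) (tensorLift (f B)) :=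
      hadamard_hom_ext fun p q => hadamard_hom_ext fun p' q' => by
        simp only [LinearMap.compr₂_apply, LinearMap.compl₁₂_apply, comp_tensor,
          tensorLift_tensor, h_comp]
    exact LinearMap.congr_fun₂ h p q

/-- The morphism of Hadamard products that is induced by a morphism of the second factor. -/
def Hom.hadamard (P : Operad.{u, v} k) (φ : Hom Q Q') : Hom (P.hadamard Q) (P.hadamard Q') :=
  Hom.ofTensor (fun A _ => (tensor P Q' A).compl₂ (φ.app A))
    (fun e p q => by
      rw [LinearMap.compl₂_apply, LinearMap.compl₂_apply, φ.map_relabel, relabel_tensor])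
    (by rw [LinearMap.compl₂_apply, φ.map_one, one_eq_tensor])
    (fun p q p' q' => by
      simp only [LinearMap.compl₂_apply, φ.map_comp, comp_tensor])

@[simp] theorem Hom.hadamard_tensor (φ : Hom Q Q') {A : Type} [Finite A] (p : P.obj A)
    (q : Q.obj A) : (φ.hadamard P).app A (tensor P Q A p q) = tensor P Q' A p (φ.app A q) :=
  tensorLift_tensor _ _ _

end Operad

namespace SetOperad

variable (S : SetOperad.{v}) (Q : Operad.{u, w} k)

/-- The sum of the coefficients. -/
def sumCoeff (k : Type u) [CommRing k] (A : Type) [Finite A] : (S.linearize k).obj A →ₗ[k] k :=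
  Finsupp.linearCombination k fun _ : S.obj A => (1 : k)

@[simp] theorem sumCoeff_single {A : Type} [Finite A] (s : S.obj A) :
    S.sumCoeff k A (S.single k s) = 1 :=
  (Finsupp.linearCombination_single k 1 _).trans (one_smul k _)

theorem sumCoeff_relabel {A B : Type} [Finite A] [Finite B] (e : A ≃ B)
    (p : (S.linearize k).obj A) :
    S.sumCoeff k B ((S.linearize k).relabel e p) = S.sumCoeff k A p :=
  LinearMap.congr_fun (f := S.sumCoeff k B ∘ₗ (S.linearize k).relabel e)
    (linearize_hom_ext S fun s => by simp) p

theorem sumCoeff_comp {A B : Type} [Finite A] [Finite B] (p : (S.linearize k).obj (Option A))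
    (q : (S.linearize k).obj B) :
    S.sumCoeff k _ ((S.linearize k).comp p q) = S.sumCoeff k _ p * S.sumCoeff k _ q :=
  LinearMap.congr_fun₂ (f := (S.linearize k).comp.compr₂ (S.sumCoeff k (A ⊕ B)))
    (g := (LinearMap.mul k k).compl₁₂ (S.sumCoeff k (Option A)) (S.sumCoeff k B))
    (linearize_hom_ext S fun s => linearize_hom_ext S fun t => by simp) p q

/-- The morphism `s ⊗ q ↦ q` for basis elements `s`. -/
def forget : Hom ((S.linearize k).hadamard Q) Q :=
  Hom.ofTensor (fun A _ => (LinearMap.lsmul k (Q.obj A)).comp (S.sumCoeff k A))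
    (fun e p q => by simp [sumCoeff_relabel])
    (by simp [one_eq_single])
    (fun p q p' q' => by simp [sumCoeff_comp, smul_smul, mul_comm])

theorem forget_tensor {A : Type} [Finite A] (p : (S.linearize k).obj A) (q : Q.obj A) :
    (S.forget Q).app A (tensor _ Q A p q) = S.sumCoeff k A p • q :=
  tensorLift_tensor _ _ _

/-- The coefficient of a basis element `s` in an element of the linear span. -/
def coeff (k : Type u) [CommRing k] {A : Type} [Finite A] (s : S.obj A) :
    (S.linearize k).obj A →ₗ[k] k :=
  Finsupp.lapply s

open Classical in
theorem coeff_single {A : Type} [Finite A] (s t : S.obj A) :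
    S.coeff k s (S.single k t) = if t = s then 1 else 0 :=
  Finsupp.single_apply

/-- The coefficient of a basis element `s` in an element of the Hadamard product. -/
def coord {A : Type} [Finite A] (s : S.obj A) :
    ((S.linearize k).hadamard Q).obj A →ₗ[k] Q.obj A :=
  tensorLift ((LinearMap.lsmul k (Q.obj A)).comp (S.coeff k s))

theorem coord_tensor {A : Type} [Finite A] (s : S.obj A) (p : (S.linearize k).obj A)
    (q : Q.obj A) : S.coord Q s (tensor _ Q A p q) = S.coeff k s p • q :=
  tensorLift_tensor _ _ _

theorem relabel_injective {A B : Type} [Finite A] [Finite B] (e : A ≃ B) :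
    Function.Injective (S.relabel e) := by
  intro s t h
  rw [← S.relabel_refl s, ← S.relabel_refl t, ← Equiv.self_trans_symm e, S.relabel_trans,
    S.relabel_trans, h]

theorem coord_relabel {A B : Type} [Finite A] [Finite B] (e : A ≃ B) (s : S.obj A)
    (p : ((S.linearize k).hadamard Q).obj A) :
    S.coord Q (S.relabel e s) (((S.linearize k).hadamard Q).relabel e p) =
      Q.relabel e (S.coord Q s p) := by
  classical
  have h : S.coeff k (S.relabel e s) ∘ₗ (S.linearize k).relabel e = S.coeff k s :=
    linearize_hom_ext S fun t => by
      simp only [LinearMap.comp_apply, relabel_single, coeff_single,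
        (S.relabel_injective e).eq_iff]
  have h' : S.coord Q (S.relabel e s) ∘ₗ ((S.linearize k).hadamard Q).relabel e =
      Q.relabel e ∘ₗ S.coord Q s :=
    hadamard_hom_ext fun p q => by
      simp only [LinearMap.comp_apply, relabel_tensor, coord_tensor, map_smul, ← h]
  exact LinearMap.congr_fun h' p

theorem coord_hadamard {Q' : Operad.{u, w'} k} (φ : Hom Q Q') {A : Type} [Finite A] (s : S.obj A)
    (p : ((S.linearize k).hadamard Q).obj A) :
    S.coord Q' s ((φ.hadamard _).app A p) = φ.app A (S.coord Q s p) :=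
  LinearMap.congr_fun (f := S.coord Q' s ∘ₗ (φ.hadamard (S.linearize k)).app A)
    (g := φ.app A ∘ₗ S.coord Q s) (hadamard_hom_ext fun p q => by
      simp only [LinearMap.comp_apply, Hom.hadamard_tensor, coord_tensor, map_smul]) p

theorem mem_hadamard_of_single {A : Type} [Finite A]
    {M : Submodule k (((S.linearize k).hadamard Q).obj A)}
    (h : ∀ (s : S.obj A) (q : Q.obj A), tensor _ Q A (S.single k s) q ∈ M)
    (p : ((S.linearize k).hadamard Q).obj A) : p ∈ M :=
  mem_hadamard_of_tensor (fun p q => S.mem_of_single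
    (M := M.comap ((tensor (S.linearize k) Q A).flip q)) (fun s => h s q) p) p

/-- Forgetting the basis elements turns the expansion of p into the sum of its coordinates, of which
only finitely many are nonzero. -/
theorem forget_mem {A : Type} [Finite A] {M : Submodule k (Q.obj A)}
    {p : ((S.linearize k).hadamard Q).obj A} (h : ∀ s, S.coord Q s p ∈ M) :
    (S.forget Q).app A p ∈ M := by
  classical
  -- Requiring the formula for every finite set above T makes the property stable under addition:
  -- for x + y the union of the two sets serves.
  have key : ∃ T : Finset (S.obj A), ∀ T', T ⊆ T' →
      (S.forget Q).app A p = ∑ s ∈ T', S.coord Q s p := by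
    clear h
    let N : Submodule k (((S.linearize k).hadamard Q).obj A) :=
      { carrier := {p | ∃ T : Finset (S.obj A), ∀ T', T ⊆ T' →
          (S.forget Q).app A p = ∑ s ∈ T', S.coord Q s p}
        add_mem' := by
          rintro x y ⟨T, hT⟩ ⟨U, hU⟩
          refine ⟨T ∪ U, fun T' h => ?_⟩
          simp only [map_add, Finset.sum_add_distrib]
          rw [hT T' (Finset.union_subset_left h), hU T' (Finset.union_subset_right h)]
        zero_mem' := ⟨∅, fun T' _ => by simp only [map_zero, Finset.sum_const_zero]⟩
        smul_mem' := by
          rintro c x ⟨T, hT⟩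
          refine ⟨T, fun T' h => ?_⟩
          simp only [map_smul, ← Finset.smul_sum]
          rw [hT T' h] }
    refine S.mem_hadamard_of_single Q (M := N) (fun s q => ⟨{s}, fun T' h => ?_⟩) p
    simp only [forget_tensor, coord_tensor, coeff_single, sumCoeff_single, ite_smul, one_smul,
      zero_smul]
    rw [Finset.sum_ite_eq, if_pos (Finset.singleton_subset_iff.1 h)]
  obtain ⟨T, hT⟩ := key
  rw [hT T subset_rfl]
  exact Submodule.sum_mem _ fun s _ => h s

end SetOperad

end Hadamard

/-! ### Associative words with two and three letters. -/

section Words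

variable {k : Type u} [CommRing k]

/-- The word `x₁x₂x₃`. -/
def wordThree : assocSetOperad.obj (Fin 3) :=
  assocMonomial [0, 1, 2] (by decide)

theorem assocWord_length {A : Type} [Finite A] (s : assocSetOperad.obj A) :
    s.1.length = Nat.card A := by
  classical
  have := Fintype.ofFinite A
  rw [Nat.card_eq_fintype_card, ← List.toFinset_card_of_nodup s.2.2.1, ← Finset.card_univ]
  congr 1
  ext a
  simp [s.2.2.2 a]

theorem exists_relabel_wordThree (s : assocSetOperad.obj (Fin 3)) :
    ∃ σ : Equiv.Perm (Fin 3), assocSetOperad.relabel σ wordThree = s := by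
  have hl := assocWord_length s
  obtain ⟨l, hs⟩ := s
  obtain ⟨a, b, c, rfl⟩ := List.length_eq_three.1 (hl.trans (Nat.card_fin 3))
  have h := hs.2.1
  clear hl
  have key : ∃ σ : Equiv.Perm (Fin 3), [σ 0, σ 1, σ 2] = [a, b, c] := by
    clear hs
    revert a b c
    decide
  obtain ⟨σ, hσ⟩ := key
  exact ⟨σ, Subtype.ext hσ⟩

/-- Together with `exists_relabel_wordThree`, this says that S₃ acts simply transitively on the
words, so computations reduce to the coordinate of x₁x₂x₃. -/
theorem eq_refl_of_relabel_wordThree {σ : Equiv.Perm (Fin 3)}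
    (h : assocSetOperad.relabel σ wordThree = wordThree) : σ = Equiv.refl _ := by
  replace h : [σ 0, σ 1, σ 2] = [0, 1, 2] := congrArg Subtype.val h
  revert σ
  decide

/-- The operation `x₂x₁` of `As`. -/
def assocOp (k : Type u) [CommRing k] : (assocOperad k).obj (Fin 2) :=
  (assocOperad k).relabel (Equiv.swap 0 1) (assocMul k)

theorem assocOp_eq : assocOp k = assocSetOperad.single k (assocMonomial [1, 0] (by decide)) :=
  (SetOperad.relabel_single _ _ _).trans (congrArg _ (Subtype.ext (by decide)))

theorem relabel_assocOp : (assocOperad k).relabel (Equiv.swap 0 1) (assocOp k) = assocMul k :=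
  (assocOperad k).relabel_symm_relabel (Equiv.swap 0 1) _

theorem single_eq_assocMul_or (s : assocSetOperad.obj (Fin 2)) :
    assocSetOperad.single k s = assocMul k ∨ assocSetOperad.single k s = assocOp k := by
  have hl := assocWord_length s
  obtain ⟨l, hs⟩ := s
  obtain ⟨a, b, rfl⟩ := List.length_eq_two.1 (hl.trans (Nat.card_fin 2))
  have h := hs.2.1
  have key : [a, b] = [0, 1] ∨ [a, b] = [1, 0] := by
    clear hs hl
    revert a b
    decide
  rw [assocOp_eq]
  exact key.imp (fun h => congrArg _ (Subtype.ext h)) fun h => congrArg _ (Subtype.ext h)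

theorem leftComp_assocMul : (assocOperad k).leftComp (assocMul k) (assocMul k) =
    assocSetOperad.single k wordThree := by
  simp only [leftComp_apply, op₂, assocMul, SetOperad.one_eq_single, SetOperad.relabel_single,
    SetOperad.comp_single]
  exact congrArg _ (Subtype.ext (by decide))

/-- With x₂x₁ at both vertices, x₃ is put first and x₂ before x₁, which gives x₃x₂x₁. This reversal
is the origin of (13) in the definition of F. -/
theorem leftComp_assocOp : (assocOperad k).leftComp (assocOp k) (assocOp k) =
    assocSetOperad.single k (assocSetOperad.relabel (Equiv.swap 0 2) wordThree) := by
  simp only [leftComp_apply, op₂, assocOp_eq, SetOperad.one_eq_single, SetOperad.relabel_single,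
    SetOperad.comp_single]
  exact congrArg _ (Subtype.ext (by decide))

end Words

/-- The Hadamard product with the operad `As`. -/
abbrev assocHadamard {k : Type u} [CommRing k] (Q : Operad.{u, w} k) : Operad.{u, max u w} k :=
  (assocOperad k).hadamard Q

theorem mem_assoc_hadamard {k : Type u} [CommRing k] {Q : Operad.{u, w} k}
    {M : Submodule k ((assocHadamard Q).obj (Fin 2))}
    (h : ∀ q, tensor _ Q _ (assocMul k) q ∈ M) (h' : ∀ q, tensor _ Q _ (assocOp k) q ∈ M)
    (x : (assocHadamard Q).obj (Fin 2)) : x ∈ M :=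
  SetOperad.mem_hadamard_of_single _ Q (fun s q => by
    rcases single_eq_assocMul_or (k := k) s with hs | hs
    · rw [hs]; exact h q
    · rw [hs]; exact h' q) x

theorem sumCoeff_assocMul {k : Type u} [CommRing k] :
    assocSetOperad.sumCoeff k (Fin 2) (assocMul k) = 1 :=
  SetOperad.sumCoeff_single _ _

theorem sumCoeff_assocOp {k : Type u} [CommRing k] :
    assocSetOperad.sumCoeff k (Fin 2) (assocOp k) = 1 := by
  rw [assocOp_eq, SetOperad.sumCoeff_single]

/-! ### Forgetting the words sends the relations of As ∘ P into F. -/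

section

variable {k : Type u} [CommRing k] {V : Type v} [AddCommGroup V] [Module k V]
  (ρ : Representation k (Equiv.Perm (Fin 2)) V)

/-- In the component of a word, the composites of two operations `s ⊗ v` in `As ⊗ 𝓕_V` only
involve trees in which the middle letter is not the outer leaf. -/
theorem coord_relabel_leftComp_mem (σ : Equiv.Perm (Fin 3))
    (x y : (assocHadamard (freeOperad ρ)).obj (Fin 2)) :
    assocSetOperad.coord (freeOperad ρ) wordThree
      ((assocHadamard (freeOperad ρ)).relabel σ
        ((assocHadamard (freeOperad ρ)).leftComp x y)) ∈ outerComposites ρ := by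
  classical
  -- If both vertices carry the same word μ, the composite carries a single word, and σ moves it to
  -- x₁x₂x₃ for exactly one σ, the inverse of τ. For x₁x₂ this is the identity and for x₂x₁ it is
  -- (13).
  have key : ∀ (μ : (assocOperad k).obj (Fin 2)) (τ : Equiv.Perm (Fin 3)),
      (assocOperad k).leftComp μ μ =
        assocSetOperad.single k (assocSetOperad.relabel τ wordThree) →
      (∀ p ∈ leftComposites ρ, (freeOperad ρ).relabel τ.symm p ∈ outerComposites ρ) →
      ∀ (v v' : V) (σ : Equiv.Perm (Fin 3)),
      assocSetOperad.coord (freeOperad ρ) wordThree ((assocHadamard (freeOperad ρ)).relabel σ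
        ((assocHadamard (freeOperad ρ)).leftComp (tensor _ (freeOperad ρ) _ μ (freeGen ρ v))
          (tensor _ (freeOperad ρ) _ μ (freeGen ρ v')))) ∈ outerComposites ρ := by
    intro μ τ hμ hτ v v' σ
    rw [leftComp_tensor, relabel_tensor, SetOperad.coord_tensor, hμ, SetOperad.relabel_single,
      SetOperad.coeff_single, ← SetOperad.relabel_trans]
    split_ifs with h
    · have h' : τ.symm = σ := by
        have := eq_refl_of_relabel_wordThree h
        rw [← Equiv.refl_trans σ, ← Equiv.symm_trans_self τ, Equiv.trans_assoc, this,
          Equiv.trans_refl]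
      rw [one_smul, ← h']
      exact hτ _ (leftComp_mem_leftComposites ρ v v')
    · rw [zero_smul]
      exact Submodule.zero_mem _
  have key₁ := key (assocMul k) (Equiv.refl _)
    (by rw [leftComp_assocMul, SetOperad.relabel_refl])
    (fun p hp => by
      rw [Equiv.refl_symm, relabel_refl]
      exact leftComposites_le_outerComposites ρ hp)
  have key₂ := key (assocOp k) (Equiv.swap 0 2) leftComp_assocOp
    (fun p hp => by
      rw [Equiv.symm_swap]
      exact relabel_mem_outerComposites ρ hp)
  -- When the two vertices carry different words, the inner generator is rewritten as a transposed
  -- generator with the outer word. By `leftComp_swap` the transposition passes to the outside and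
  -- is absorbed into σ.
  have swap₁ : ∀ v, tensor _ (freeOperad ρ) _ (assocMul k) (freeGen ρ v) =
      (assocHadamard (freeOperad ρ)).relabel (Equiv.swap 0 1)
        (tensor _ (freeOperad ρ) _ (assocOp k) (freeGen ρ (ρ (Equiv.swap 0 1) v))) := by
    intro v
    rw [relabel_tensor, relabel_assocOp, freeGen_relabel]
    exact congrArg _ ((freeOperad ρ).relabel_symm_relabel (Equiv.swap 0 1) _).symm
  have swap₂ : ∀ v, tensor _ (freeOperad ρ) _ (assocOp k) (freeGen ρ v) =
      (assocHadamard (freeOperad ρ)).relabel (Equiv.swap 0 1)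
        (tensor _ (freeOperad ρ) _ (assocMul k) (freeGen ρ (ρ (Equiv.swap 0 1) v))) := by
    intro v
    rw [relabel_tensor, freeGen_relabel]
    exact congrArg _ ((freeOperad ρ).relabel_symm_relabel (Equiv.swap 0 1) _).symm
  let f := assocSetOperad.coord (freeOperad ρ) wordThree ∘ₗ (assocHadamard (freeOperad ρ)).relabel σ
  refine mem_assoc_hadamard (M := (outerComposites ρ).comap (f ∘ₗ (assocHadamard (freeOperad ρ)).leftComp.flip y))
    (fun q => ?_) (fun q => ?_) x
  · obtain ⟨v, rfl⟩ := freeGenₗ_surjective ρ q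
    refine mem_assoc_hadamard (M := (outerComposites ρ).comap (f ∘ₗ
      (assocHadamard (freeOperad ρ)).leftComp
        (tensor _ (freeOperad ρ) _ (assocMul k) (freeGen ρ v)))) (fun q => ?_) (fun q => ?_) y
    · obtain ⟨v', rfl⟩ := freeGenₗ_surjective ρ q
      exact key₁ v v' σ
    · obtain ⟨v', rfl⟩ := freeGenₗ_surjective ρ q
      rw [freeGenₗ_apply, swap₂ v', Submodule.mem_comap, LinearMap.comp_apply, LinearMap.comp_apply,
        leftComp_swap, relabel_relabel]
      exact key₁ _ _ _
  · obtain ⟨v, rfl⟩ := freeGenₗ_surjective ρ q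
    refine mem_assoc_hadamard (M := (outerComposites ρ).comap (f ∘ₗ
      (assocHadamard (freeOperad ρ)).leftComp
        (tensor _ (freeOperad ρ) _ (assocOp k) (freeGen ρ v)))) (fun q => ?_) (fun q => ?_) y
    · obtain ⟨v', rfl⟩ := freeGenₗ_surjective ρ q
      rw [freeGenₗ_apply, swap₁ v', Submodule.mem_comap, LinearMap.comp_apply, LinearMap.comp_apply,
        leftComp_swap, relabel_relabel]
      exact key₂ _ _ _
    · obtain ⟨v', rfl⟩ := freeGenₗ_surjective ρ q
      exact key₂ v v' σ

theorem coord_treeEval_mem {X : Type w}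
    (f : X → (assocHadamard (freeOperad ρ)).obj (Fin 2)) (σ : Equiv.Perm (Fin 3))
    (z : (treeOperad k X).obj (Fin 3)) :
    assocSetOperad.coord (freeOperad ρ) wordThree
      ((assocHadamard (freeOperad ρ)).relabel σ
        (treeEval (assocHadamard (freeOperad ρ)) f (Fin 3) z)) ∈ outerComposites ρ := by
  refine SetOperad.mem_of_single (treeSetOperad X) (M := (outerComposites ρ).comap
    (assocSetOperad.coord (freeOperad ρ) wordThree ∘ₗ
      (assocHadamard (freeOperad ρ)).relabel σ ∘ₗ
      treeEval (assocHadamard (freeOperad ρ)) f (Fin 3))) (fun t => ?_) z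
  rw [Submodule.mem_comap, LinearMap.comp_apply, LinearMap.comp_apply]
  obtain ⟨x, y, τ, h | h⟩ := exists_treeEval_eq (assocHadamard (freeOperad ρ)) f t
  · rw [h, relabel_relabel]
    exact coord_relabel_leftComp_mem ρ _ _ _
  · rw [h, relabel_relabel]
    exact coord_relabel_leftComp_mem ρ _ _ _

variable {R : Submodule k ((freeOperad ρ).obj (Fin 3))}

variable (R) in
/-- The linear map `As(2) ⊗ P(2) → V`, `x₁x₂ ⊗ v ↦ v`, `x₂x₁ ⊗ v ↦ v`. -/
def forgetWord : (assocHadamard (quadraticOperad ρ R)).obj (Fin 2) →ₗ[k] V :=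
  (quadraticEquiv ρ R).symm.toLinearMap ∘ₗ (assocSetOperad.forget (quadraticOperad ρ R)).app (Fin 2)

theorem forgetWord_tensor (p : (assocOperad k).obj (Fin 2))
    (q : (quadraticOperad ρ R).obj (Fin 2)) :
    forgetWord ρ R (tensor _ _ _ p q) =
      assocSetOperad.sumCoeff k (Fin 2) p • (quadraticEquiv ρ R).symm q := by
  rw [forgetWord, LinearMap.comp_apply, SetOperad.forget_tensor, map_smul]
  rfl

theorem forgetWord_relabel (σ : Equiv.Perm (Fin 2))
    (x : (assocHadamard (quadraticOperad ρ R)).obj (Fin 2)) :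
    forgetWord ρ R ((assocHadamard (quadraticOperad ρ R)).relabel σ x) =
      ρ σ (forgetWord ρ R x) := by
  rw [forgetWord, LinearMap.comp_apply, Hom.map_relabel]
  exact quadraticEquiv_symm_relabel ρ R σ _

theorem forgetWord_assocMul (q : (quadraticOperad ρ R).obj (Fin 2)) :
    forgetWord ρ R (tensor _ _ _ (assocMul k) q) = (quadraticEquiv ρ R).symm q := by
  rw [forgetWord_tensor, sumCoeff_assocMul, one_smul]

theorem forgetWord_assocOp (q : (quadraticOperad ρ R).obj (Fin 2)) :
    forgetWord ρ R (tensor _ _ _ (assocOp k) q) = (quadraticEquiv ρ R).symm q := by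
  rw [forgetWord_tensor, sumCoeff_assocOp, one_smul]

/-- The relations of the white product `As ∘ P` become elements of `F` after forgetting the
words. -/
theorem freeMk_treeMap_mem_outerRelations
    (hR : ∀ (σ : Equiv.Perm (Fin 3)), ∀ r ∈ R, (freeOperad ρ).relabel σ r ∈ R)
    {z : (treeOperad k ((assocHadamard (quadraticOperad ρ R)).obj (Fin 2))).obj (Fin 3)}
    (hz : treeEval (assocHadamard (quadraticOperad ρ R)) (fun h => h) (Fin 3) z = 0) :
    freeMk ρ (Fin 3) ((treeMap k (forgetWord ρ R)).app (Fin 3) z) ∈ outerRelations ρ R := by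
  let g : (quadraticOperad ρ R).obj (Fin 2) →ₗ[k] (freeOperad ρ).obj (Fin 2) :=
    freeGenₗ ρ ∘ₗ (quadraticEquiv ρ R).symm.toLinearMap
  -- Since P(2) = V = 𝓕_V(2), the labels lift to As ⊗ 𝓕_V. There z takes a value whose coordinates
  -- are actual elements of 𝓕_V(3) rather than classes modulo R.
  let f : (assocHadamard (quadraticOperad ρ R)).obj (Fin 2) →ₗ[k] (assocHadamard (freeOperad ρ)).obj (Fin 2) := tensorLift ((tensor _ _ _).compl₂ g)
  have hf : ∀ p q, f (tensor _ _ _ p q) = tensor _ _ _ p (g q) := fun p q =>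
    tensorLift_tensor _ _ _
  have h₁ : ∀ x, ((quadraticHom ρ R).hadamard (assocOperad k)).app (Fin 2) (f x) = x :=
    LinearMap.congr_fun (f := ((quadraticHom ρ R).hadamard (assocOperad k)).app (Fin 2) ∘ₗ f)
      (g := LinearMap.id) (hadamard_hom_ext fun p q => by
        rw [LinearMap.comp_apply, hf, Hom.hadamard_tensor]
        exact congrArg _ ((quadraticEquiv ρ R).apply_symm_apply q))
  have h₂ : ∀ x, (assocSetOperad.forget (freeOperad ρ)).app (Fin 2) (f x) =
      freeGen ρ (forgetWord ρ R x) :=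
    LinearMap.congr_fun (f := (assocSetOperad.forget (freeOperad ρ)).app (Fin 2) ∘ₗ f)
      (g := freeGenₗ ρ ∘ₗ forgetWord ρ R) (hadamard_hom_ext fun p q => by
        rw [LinearMap.comp_apply, LinearMap.comp_apply, hf, SetOperad.forget_tensor,
          forgetWord_tensor, map_smul]
        rfl)
  have h₃ : freeMk ρ (Fin 3) ((treeMap k (forgetWord ρ R)).app (Fin 3) z) =
      (assocSetOperad.forget (freeOperad ρ)).app (Fin 3) (treeEval (assocHadamard (freeOperad ρ)) f (Fin 3) z) := by
    have h := ((treeMap k (forgetWord ρ R)).trans (freeHom ρ)).app_eq_treeEval z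
    rw [Hom.map_treeEval, funext h₂]
    refine h.trans (congrArg (fun φ => treeEval (freeOperad ρ) φ (Fin 3) z) (funext fun x => ?_))
    rw [Hom.trans_app, treeMap_treeGen]
    rfl
  have h₄ : ((quadraticHom ρ R).hadamard (assocOperad k)).app (Fin 3) (treeEval (assocHadamard (freeOperad ρ)) f (Fin 3) z) =
      0 := by
    rw [Hom.map_treeEval, funext h₁]
    exact hz
  rw [h₃]
  refine SetOperad.forget_mem _ _ fun s => ?_
  obtain ⟨σ, rfl⟩ := exists_relabel_wordThree s
  have h₅ : treeEval (assocHadamard (freeOperad ρ)) f (Fin 3) z = (assocHadamard (freeOperad ρ)).relabel σ ((assocHadamard (freeOperad ρ)).relabel σ.symm (treeEval (assocHadamard (freeOperad ρ)) f (Fin 3) z)) :=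
    ((assocHadamard (freeOperad ρ)).relabel_relabel_symm σ _).symm
  rw [h₅, SetOperad.coord_relabel]
  -- Moving the word s to x₁x₂x₃ by the inverse of σ leaves a coordinate of that word. It has the
  -- outer shape by `coord_treeEval_mem`, and it lies in R because its image in P(3) is a coordinate
  -- of zero.
  refine relabel_mem_outerRelations ρ σ (Submodule.mem_iSup_of_mem (1 : Equiv.Perm (Fin 3))
    ⟨_, ⟨coord_treeEval_mem ρ f σ.symm z, ?_⟩, relabel_refl _ _⟩)
  rw [SetLike.mem_coe, ← quadraticHom_eq_zero ρ hR, ← SetOperad.coord_hadamard, Hom.map_relabel,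
    h₄, map_zero, map_zero]

end

/-! ### Generators of As ∘ P modulo the identifications. -/

section

variable {k : Type u} [CommRing k]

/-- The quotient of `As ∘ P` by the identifications `g_v = (12) h_v`, `(12) g_v = h_v`. -/
abbrev identifiedProduct (P : Operad.{u, w} k) : Operad.{u, max u w} k :=
  (whiteProduct (assocOperad k) P).quotient
    ((whiteProduct (assocOperad k) P).span (identifications P))

/-- The projection of the free operad on `As(2) ⊗ P(2)` to `As ∘ P` modulo the identifications. -/
def identifiedHom (P : Operad.{u, w} k) :
    Hom (freeOperad ((assocHadamard P).rep 2)) (identifiedProduct P) :=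
  (quadraticHom ((assocHadamard P).rep 2) (arityThreeRelations (assocHadamard P))).trans
    (mkHom _ _)

theorem identifiedHom_surjective (P : Operad.{u, w} k) (A : Type) [Finite A] :
    Function.Surjective ((identifiedHom P).app A) :=
  (mkQ_surjective _).comp (quadraticHom_surjective _ _ A)

theorem identifiedHom_eq_zero (P : Operad.{u, w} k)
    {z : (treeOperad k ((assocHadamard P).obj (Fin 2))).obj (Fin 3)}
    (hz : treeEval (assocHadamard P) (fun h => h) (Fin 3) z = 0) :
    (identifiedHom P).app (Fin 3) (freeMk ((assocHadamard P).rep 2) (Fin 3) z) = 0 := by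
  exact (congrArg (mkQ _ _ _) (quadraticHom_eq_zero_of_mem _
    (arityThreeRelations (assocHadamard P)) ⟨z, hz, rfl⟩)).trans (map_zero _)

/-- The class of the generator `x ∈ As(2) ⊗ P(2)`. -/
def identifiedGen (P : Operad.{u, w} k) :
    (assocHadamard P).obj (Fin 2) →ₗ[k] (identifiedProduct P).obj (Fin 2) :=
  (identifiedHom P).app (Fin 2) ∘ₗ freeGenₗ ((assocHadamard P).rep 2)

theorem relabel_identifiedGen (P : Operad.{u, w} k) (σ : Equiv.Perm (Fin 2))
    (x : (assocHadamard P).obj (Fin 2)) :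
    (identifiedProduct P).relabel σ (identifiedGen P x) =
      identifiedGen P ((assocHadamard P).relabel σ x) := by
  rw [identifiedGen, LinearMap.comp_apply, ← Hom.map_relabel, freeGenₗ_apply, ← freeGen_relabel]
  rfl

theorem relabel_whiteGen (P : Operad.{u, w} k) (σ : Equiv.Perm (Fin 2))
    (a : (assocOperad k).obj (Fin 2)) (p : P.obj (Fin 2)) :
    (whiteProduct (assocOperad k) P).relabel σ (whiteGen (assocOperad k) P a p) =
      whiteGen (assocOperad k) P ((assocOperad k).relabel σ a) (P.relabel σ p) := by
  have h := freeGen_relabel ((assocHadamard P).rep 2) σ (tensor (assocOperad k) P _ a p)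
  exact (congrArg (mkQ _ _ _) h).symm

theorem relabel_succOp (P : Operad.{u, w} k) (p : P.obj (Fin 2)) :
    (whiteProduct (assocOperad k) P).relabel (Equiv.swap 0 1) (succOp P p) =
      whiteGen (assocOperad k) P (assocOp k) p := by
  rw [succOp, relabel_whiteGen]
  exact congrArg _ (P.relabel_symm_relabel (Equiv.swap 0 1) p)

theorem relabel_precOp (P : Operad.{u, w} k) (p : P.obj (Fin 2)) :
    (whiteProduct (assocOperad k) P).relabel (Equiv.swap 0 1) (precOp P p) =
      whiteGen (assocOperad k) P (assocOp k) (P.relabel (Equiv.swap 0 1) p) := by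
  rw [precOp, relabel_whiteGen]
  rfl

/-- Since (12)g_v = x₂x₁ ⊗ v, the identification (12)g_v = h_v makes the word on a generator
irrelevant. -/
theorem identifiedGen_assocOp (P : Operad.{u, w} k) (p : P.obj (Fin 2)) :
    identifiedGen P (tensor _ P _ (assocOp k) p) = identifiedGen P (tensor _ P _ (assocMul k) p) := by
  have h : mkQ _ _ (Fin 2) ((whiteProduct (assocOperad k) P).relabel (Equiv.swap 0 1)
      (succOp P p) - precOp P p) = 0 :=
    (mkQ_eq_zero _).2 (subset_span _ (identifications P) (Or.inr ⟨p, rfl⟩))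
  rw [relabel_succOp, map_sub, sub_eq_zero] at h
  exact h

end

/-! ### The mutually inverse morphisms between the identified product and 𝓟(V, F). -/

section

variable {k : Type u} [CommRing k] {V : Type v} [AddCommGroup V] [Module k V]
  (ρ : Representation k (Equiv.Perm (Fin 2)) V) (R : Submodule k ((freeOperad ρ).obj (Fin 3)))

/-- The linear map `V → As(2) ⊗ P(2)`, `v ↦ x₁x₂ ⊗ v`. -/
def mulTensor : V →ₗ[k] (assocHadamard (quadraticOperad ρ R)).obj (Fin 2) :=
  tensor _ (quadraticOperad ρ R) _ (assocMul k) ∘ₗ (quadraticEquiv ρ R).toLinearMap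

theorem mulTensor_apply (x : V) : mulTensor ρ R x =
    tensor _ (quadraticOperad ρ R) _ (assocMul k) (quadraticEquiv ρ R x) := rfl

theorem forgetWord_mulTensor (x : V) : forgetWord ρ R (mulTensor ρ R x) = x := by
  rw [mulTensor_apply, forgetWord_assocMul, LinearEquiv.symm_apply_apply]

/-- Replacing the word of a generator by x₁x₂ does not change its class. This yields both the
equivariance of v ↦ x₁x₂ ⊗ v and one of the two inverse identities. -/
theorem identifiedGen_mulTensor_forgetWord
    (x : (assocHadamard (quadraticOperad ρ R)).obj (Fin 2)) :
    identifiedGen _ (mulTensor ρ R (forgetWord ρ R x)) = identifiedGen _ x := by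
  refine mem_assoc_hadamard (M := LinearMap.eqLocus
    (identifiedGen _ ∘ₗ mulTensor ρ R ∘ₗ forgetWord ρ R) (identifiedGen _)) (fun q => ?_)
    (fun q => ?_) x
  · rw [LinearMap.mem_eqLocus, LinearMap.comp_apply, LinearMap.comp_apply, forgetWord_assocMul,
      mulTensor_apply, LinearEquiv.apply_symm_apply]
  · rw [LinearMap.mem_eqLocus, LinearMap.comp_apply, LinearMap.comp_apply, forgetWord_assocOp,
      mulTensor_apply, LinearEquiv.apply_symm_apply, identifiedGen_assocOp]

/-- The morphism `v ↦ x₁x₂ ⊗ v` from the free operad to `As ∘ P` modulo the identifications. -/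
def freeToIdentified : Hom (freeOperad ρ) (identifiedProduct (quadraticOperad ρ R)) :=
  freeLift ρ (((treeMap k (mulTensor ρ R)).trans (freeHom _)).trans (identifiedHom _))
    (identifiedGen _ ∘ₗ mulTensor ρ R)
    (fun x => by
      rw [Hom.trans_app, Hom.trans_app, treeMap_treeGen]
      rfl)
    -- The transposition turns x₁x₂ into x₂x₁, so `mulTensor` alone is not equivariant; the
    -- identifications repair this.
    (fun σ x => by
      rw [LinearMap.comp_apply, LinearMap.comp_apply, relabel_identifiedGen,
        ← identifiedGen_mulTensor_forgetWord ρ R (Operad.relabel _ _ _), forgetWord_relabel,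
        forgetWord_mulTensor])

theorem freeToIdentified_freeMk {A : Type} [Finite A] (p : (treeOperad k V).obj A) :
    (freeToIdentified ρ R).app A (freeMk ρ A p) =
      (identifiedHom _).app A (freeMk _ A ((treeMap k (mulTensor ρ R)).app A p)) := rfl

theorem freeToIdentified_freeGen (x : V) :
    (freeToIdentified ρ R).app (Fin 2) (freeGen ρ x) = identifiedGen _ (mulTensor ρ R x) := by
  rw [freeGen, freeToIdentified_freeMk, treeMap_treeGen]
  rfl

/-- Every composite in `V ⊗⃗ V` has a lift to the free operad on `As(2) ⊗ P(2)` whose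
generators carry the word `μ`. -/
theorem exists_lift_of_mem_leftComposites {μ : (assocOperad k).obj (Fin 2)}
    (hμ : ∀ q, identifiedGen (quadraticOperad ρ R) (tensor _ _ _ μ q) =
      identifiedGen _ (tensor _ _ _ (assocMul k) q))
    (σ : Equiv.Perm (Fin 3)) {p : (freeOperad ρ).obj (Fin 3)} (hp : p ∈ leftComposites ρ) :
    ∃ z, treeEval (assocHadamard (quadraticOperad ρ R)) (fun h => h) (Fin 3) z =
        tensor _ _ _ ((assocOperad k).relabel σ ((assocOperad k).leftComp μ μ))
          ((quadraticHom ρ R).app (Fin 3) ((freeOperad ρ).relabel σ p)) ∧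
      (identifiedHom _).app (Fin 3) (freeMk _ (Fin 3) z) =
        (freeToIdentified ρ R).app (Fin 3) ((freeOperad ρ).relabel σ p) := by
  induction hp using Submodule.span_induction with
  | mem p hp =>
    obtain ⟨⟨x, y⟩, rfl⟩ := hp
    beta_reduce
    rw [freeMk_treeLeft]
    -- Putting μ at both vertices makes the value a pure tensor whose word does not depend on x and
    -- y, so the statement is preserved by sums.
    refine ⟨(treeOperad k _).relabel σ
      (treeLeft k (tensor _ _ _ μ (quadraticEquiv ρ R x)) (tensor _ _ _ μ (quadraticEquiv ρ R y))),
      ?_, ?_⟩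
    · rw [treeEval_relabel_treeLeft, leftComp_tensor, relabel_tensor, Hom.map_relabel,
        Hom.map_leftComp]
      rfl
    · have h : ∀ x, (identifiedHom _).app (Fin 2) (freeGen ((assocHadamard
          (quadraticOperad ρ R)).rep 2) (tensor _ _ _ μ (quadraticEquiv ρ R x))) =
          (freeToIdentified ρ R).app (Fin 2) (freeGen ρ x) := fun x => by
        rw [freeToIdentified_freeGen]
        exact hμ _
      rw [← freeHom_app, Hom.map_relabel, Hom.map_relabel, freeHom_app, freeMk_treeLeft,
        Hom.map_leftComp, h, h, ← Hom.map_leftComp, Hom.map_relabel]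
  | zero => exact ⟨0, by simp only [map_zero], by simp only [map_zero]⟩
  | add p q _ _ hp hq =>
    obtain ⟨z, hz, hz'⟩ := hp
    obtain ⟨y, hy, hy'⟩ := hq
    exact ⟨z + y, by simp only [map_add, hz, hy], by simp only [map_add, hz', hy']⟩
  | smul c p _ hp =>
    obtain ⟨z, hz, hz'⟩ := hp
    exact ⟨c • z, by simp only [map_smul, hz], by simp only [map_smul, hz']⟩

/-- An element of R of the outer shape lifts to a combination of trees whose value is concentrated
in the word x₁x₂x₃, with the given element as its coefficient. The value is zero in As ⊗ P, so the
lift is a relation of the white product. -/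
theorem freeToIdentified_eq_zero {r : (freeOperad ρ).obj (Fin 3)} (h : r ∈ outerRelations ρ R) :
    (freeToIdentified ρ R).app (Fin 3) r = 0 := by
  have key : outerRelations ρ R ≤ LinearMap.ker ((freeToIdentified ρ R).app (Fin 3)) := by
    refine iSup_le fun σ => Submodule.map_le_iff_le_comap.2 ?_
    rintro r ⟨hr, hrR⟩
    rw [Submodule.mem_comap, LinearMap.mem_ker, Hom.map_relabel]
    obtain ⟨p, hp, _, ⟨q, hq, rfl⟩, rfl⟩ := Submodule.mem_sup.1 hr
    -- The words are chosen to match: x₁x₂ on p gives x₁x₂x₃, while x₂x₁ on q gives x₃x₂x₁, which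
    -- (13) turns back into x₁x₂x₃.
    obtain ⟨y, hy, hy'⟩ := exists_lift_of_mem_leftComposites ρ R (fun _ => rfl) (Equiv.refl _) hp
    obtain ⟨z, hz, hz'⟩ := exists_lift_of_mem_leftComposites ρ R
      (identifiedGen_assocOp (quadraticOperad ρ R)) (Equiv.swap 0 2) hq
    rw [relabel_refl, relabel_refl, leftComp_assocMul] at hy
    rw [relabel_refl] at hy'
    rw [leftComp_assocOp, ← SetOperad.relabel_single] at hz
    replace hz := hz.trans (congrArg (fun s => tensor _ (quadraticOperad ρ R) _ s _)
      ((assocOperad k).relabel_symm_relabel (Equiv.swap 0 2) _))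
    have h₀ : treeEval (assocHadamard (quadraticOperad ρ R)) (fun h => h) (Fin 3) (y + z) = 0 := by
      rw [map_add, hy, hz, ← map_add, ← map_add, quadraticHom_eq_zero_of_mem ρ R hrR, map_zero]
    have h₁ := identifiedHom_eq_zero _ h₀
    rw [map_add, map_add, hy', hz', ← map_add] at h₁
    rw [h₁, map_zero]
  exact key h

/-- The morphism `v ↦ x₁x₂ ⊗ v` from `𝓟(V, F)` to `As ∘ P` modulo the identifications. -/
def outerToIdentified : Hom (quadraticOperad ρ (outerRelations ρ R))
    (identifiedProduct (quadraticOperad ρ R)) :=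
  (freeToIdentified ρ R).liftSpan _ fun _ h => freeToIdentified_eq_zero ρ R h

theorem outerToIdentified_quadraticHom {A : Type} [Finite A] (p : (freeOperad ρ).obj A) :
    (outerToIdentified ρ R).app A ((quadraticHom ρ (outerRelations ρ R)).app A p) =
      (freeToIdentified ρ R).app A p := rfl

/-- The morphism from the free operad on `As(2) ⊗ P(2)` to the free operad on `V` that forgets
the words. -/
def freeForget : Hom (freeOperad ((assocHadamard (quadraticOperad ρ R)).rep 2)) (freeOperad ρ) :=
  freeLift _ ((treeMap k (forgetWord ρ R)).trans (freeHom ρ)) (freeGenₗ ρ ∘ₗ forgetWord ρ R)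
    (fun x => by
      rw [Hom.trans_app, treeMap_treeGen]
      rfl)
    (fun σ x => by
      rw [LinearMap.comp_apply, LinearMap.comp_apply, freeGenₗ_apply, freeGenₗ_apply,
        ← freeGen_relabel, ← forgetWord_relabel]
      rfl)

theorem freeForget_freeMk {A : Type} [Finite A]
    (p : (treeOperad k ((assocHadamard (quadraticOperad ρ R)).obj (Fin 2))).obj A) :
    (freeForget ρ R).app A (freeMk _ A p) =
      freeMk ρ A ((treeMap k (forgetWord ρ R)).app A p) := rfl

theorem freeForget_freeGen (x : (assocHadamard (quadraticOperad ρ R)).obj (Fin 2)) :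
    (freeForget ρ R).app (Fin 2) (freeGen _ x) = freeGen ρ (forgetWord ρ R x) := by
  rw [freeGen, freeForget_freeMk, treeMap_treeGen]
  rfl

variable {R} (hR : ∀ (σ : Equiv.Perm (Fin 3)), ∀ r ∈ R, (freeOperad ρ).relabel σ r ∈ R)

/-- The morphism from `As ∘ P` to `𝓟(V, F)` that forgets the words. -/
def whiteForget : Hom (whiteProduct (assocOperad k) (quadraticOperad ρ R))
    (quadraticOperad ρ (outerRelations ρ R)) :=
  ((freeForget ρ R).trans (quadraticHom ρ _)).liftSpan _ (by
    rintro _ ⟨z, hz, rfl⟩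
    rw [Hom.trans_app]
    exact quadraticHom_eq_zero_of_mem ρ _ (freeMk_treeMap_mem_outerRelations ρ hR hz))

theorem whiteForget_whiteGen (a : (assocOperad k).obj (Fin 2))
    (p : (quadraticOperad ρ R).obj (Fin 2)) :
    (whiteForget ρ hR).app (Fin 2) (whiteGen _ _ a p) =
      quadraticEquiv ρ _ (forgetWord ρ R (tensor _ _ _ a p)) :=
  congrArg ((quadraticHom ρ (outerRelations ρ R)).app (Fin 2)) (freeForget_freeGen ρ R _)

/-- The morphism from `As ∘ P` modulo the identifications to `𝓟(V, F)` that forgets the words. -/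
def identifiedToOuter : Hom (identifiedProduct (quadraticOperad ρ R))
    (quadraticOperad ρ (outerRelations ρ R)) :=
  (whiteForget ρ hR).liftSpan _ (by
    -- In both families the two terms carry the same operation of P with different words, so they
    -- agree once the words are forgotten.
    rintro _ (⟨p, rfl⟩ | ⟨p, rfl⟩)
    · rw [relabel_precOp, map_sub, succOp, whiteForget_whiteGen, whiteForget_whiteGen,
        forgetWord_assocMul, forgetWord_assocOp, sub_self]
    · rw [relabel_succOp, map_sub, precOp, whiteForget_whiteGen, whiteForget_whiteGen,
        forgetWord_assocMul, forgetWord_assocOp, sub_self])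

theorem identifiedToOuter_identifiedHom {A : Type} [Finite A]
    (p : (freeOperad ((assocHadamard (quadraticOperad ρ R)).rep 2)).obj A) :
    (identifiedToOuter ρ hR).app A ((identifiedHom _).app A p) =
      (quadraticHom ρ _).app A ((freeForget ρ R).app A p) := rfl

/-- The quotient of `As ∘ 𝓟(V, R)` by the identifications is `𝓟(V, F)`. -/
def identifiedProductIso :
    Iso (identifiedProduct (quadraticOperad ρ R)) (quadraticOperad ρ (outerRelations ρ R)) :=
  (identifiedToOuter ρ hR).toIso (outerToIdentified ρ R)
    (fun A _ q => by
      obtain ⟨q, rfl⟩ := identifiedHom_surjective _ A q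
      obtain ⟨q, rfl⟩ := freeMk_surjective _ A q
      -- Pulling back along the surjection from the tree operad reduces the inverse identity to
      -- generators.
      refine Hom.tree_ext (φ := (((freeHom _).trans (identifiedHom _)).trans
        (identifiedToOuter ρ hR)).trans (outerToIdentified ρ R))
        (ψ := (freeHom _).trans (identifiedHom _)) (fun x => ?_) q
      have h : (freeHom ((assocHadamard (quadraticOperad ρ R)).rep 2)).app (Fin 2)
        (treeGen k x) = freeGen _ x := rfl
      rw [Hom.trans_app, Hom.trans_app, Hom.trans_app, h, identifiedToOuter_identifiedHom,
        outerToIdentified_quadraticHom, freeForget_freeGen, freeToIdentified_freeGen]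
      exact identifiedGen_mulTensor_forgetWord ρ R x)
    (fun A _ q => by
      obtain ⟨q, rfl⟩ := quadraticHom_surjective _ _ A q
      obtain ⟨q, rfl⟩ := freeMk_surjective _ A q
      refine Hom.tree_ext (φ := (((freeHom ρ).trans (quadraticHom ρ _)).trans
        (outerToIdentified ρ R)).trans (identifiedToOuter ρ hR))
        (ψ := (freeHom ρ).trans (quadraticHom ρ _)) (fun x => ?_) q
      have h : (freeHom ρ).app (Fin 2) (treeGen k x) = freeGen ρ x := rfl
      rw [Hom.trans_app, Hom.trans_app, Hom.trans_app, h, outerToIdentified_quadraticHom,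
        freeToIdentified_freeGen]
      refine (congrArg ((quadraticHom ρ _).app (Fin 2)) (freeForget_freeGen ρ R _)).trans ?_
      rw [forgetWord_mulTensor])

end

/-! ### Conclusion by comparison of dimensions in arity three. -/

theorem mainTheorem1 {k : Type u} [Field k] {V : Type v} [AddCommGroup V] [Module k V]
    [FiniteDimensional k V] (ρ : Representation k (Equiv.Perm (Fin 2)) V)
    (R : Submodule k ((freeOperad ρ).obj (Fin 3)))
    (hR : ∀ (σ : Equiv.Perm (Fin 3)), ∀ r ∈ R, (freeOperad ρ).relabel σ r ∈ R) :
    (AdmitsNonsymmetricVersion (quadraticOperad ρ R) ↔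
      Module.rank k ((quadraticOperad ρ R).obj (Fin 3)) =
        Module.rank k ((quadraticOperad ρ (outerRelations ρ R)).obj (Fin 3))) ∧
    (Module.rank k ((quadraticOperad ρ R).obj (Fin 3)) =
        Module.rank k ((quadraticOperad ρ (outerRelations ρ R)).obj (Fin 3)) ↔
      outerRelations ρ R = R) := by
  have h := rank_quadraticOperad_eq_iff ρ hR
    (fun σ _ hr => relabel_mem_outerRelations ρ σ hr) (outerRelations_le ρ hR)
  refine ⟨⟨?_, fun hr => ?_⟩, h⟩
  -- Nothing is required of f on generators: any isomorphism preserves the rank in arity three.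
  · rintro ⟨f⟩
    exact (f.equiv (Fin 3)).symm.rank_eq.trans
      ((identifiedProductIso ρ hR).equiv (Fin 3)).rank_eq
  · have e := identifiedProductIso ρ hR
    rw [h.1 hr] at e
    exact ⟨e⟩

end
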